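/- Let $k$ be an algebraically closed field of characteristic zero and let $(R,\mathfrak m)$ be a local (commutative) $k$-algebra with residue field $k$; write $0$ for the closed point of $\mathrm{Spec}(R)$. Matrices over $R$ are considered up to left-right equivalence, $A\sim UAV$ with $U,V$ invertible over $R$, and $I_j(A)\subseteq R$ denotes the ideal generated by the $j\times j$ minors of $A$. Let $1<m\le n$ and let $A$ be an $m\times n$ matrix with entries in $\mathfrak m$. For an ideal $J\subseteq R$ let $X=V(J)\subseteq\mathrm{Spec}(R)$ (with its reduced structure), let $E_X=\{(x,z): x\in X,\ A(x)z=0\}\subseteq X\times\mathbb A^n\subseteq \mathrm{Spec}\,R[z_1,\dots,z_n]$ be the family of kernels of $A$ over $X$, let $Y\subseteq X$ be the largest open subset over which $E_X$ is an embedded vector bundle (i.e. over which the rank of $A(x)$ is locally constant), and let $\overline{E_Y}$ be the closure of $E_Y=E_X|_Y$ in $\mathrm{Spec}\,R[z_1,\dots,z_n]$. Denote by $V(A,X)\subseteq k^n$ the $k$-linear span of the set of those $v\in k^n$ for which $(0,v)\in\overline{E_Y}$, i.e. the span of the limits at the origin of the kernel fibres of $A$ over $X$. (1) Suppose that $I_m(A)$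 is generated by non-zero-divisors, that $\ker(A)\subseteq I_m(A)R^{n}$, and that $I_m(A)=J_1J_2$ with proper ideals $J_1,J_2$ satisfying $J_1\cap J_2=J_1J_2$. Put $X_i=V(J_i)$ and $V_i=V(A,X_i)$. If $A$ is decomposable along this factorization, i.e. $A\sim\begin{pmatrix}A_1&0\\0&A_2\end{pmatrix}$ with $A_i$ of size $m_i\times n_i$, $m_1+m_2=m$, $n_1+n_2=n$ and $I_{m_i}(A_i)=J_i$ for $i=1,2$, then $V_1\cap V_2=0$, i.e. $\mathrm{Span}(V_1\cup V_2)=V_1\oplus V_2$. (2) Suppose that $R$ is a regular local ring, that $A$ is square ($m=n$), and that the hypersurface $\{\det A=0\}$ is the reduced union of smooth hypersurface germs $X_1,\dots,X_r$, i.e. $X_i=\{f_i=0\}$ with $f_i\in\mathfrak m\setminus\mathfrak m^2$ and $(\det A)=\bigcap_{i=1}^r (f_i)$. Put $V_i=V(A,X_i)$. If $\mathrm{Span}(\bigcup_i V_i)=\bigoplus_i V_i$, then $A$ is completely decomposable: $A\sim A_1\oplus\cdots\oplus A_r$ with square blocks $A_i$ satisfying $(\det A_i)=(f_i)$ for all $i$.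 -/

import Mathlib

namespace KernelFibres

open IsLocalRing

section Matrices

variable {R : Type*} [CommRing R]

/-- The ideal `I_j(A)` generated by the `j × j` minors of `A`. -/
def minorsIdeal {m n : ℕ} (j : ℕ) (A : Matrix (Fin m) (Fin n) R) : Ideal R :=
  Ideal.span {d | ∃ (r : Fin j → Fin m) (c : Fin j → Fin n), d = (A.submatrix r c).det}

/-- Left-right equivalence of matrices, `B = U A V` with `U`, `V` invertible over `R`. -/
def LREquiv {m n : ℕ} (A B : Matrix (Fin m) (Fin n) R) : Prop :=
  ∃ (U : GL (Fin m) R) (V : GL (Fin n) R),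
    (U : Matrix (Fin m) (Fin m) R) * A * (V : Matrix (Fin n) (Fin n) R) = B

/-- `A` is decomposable along the factorization `I_m(A) = J₁ J₂`: it is equivalent to a block
diagonal matrix `A₁ ⊕ A₂`, with `A₁` and `A₂` of sizes `m₁ × n₁` and `m₂ × n₂`, where
`m₁ + m₂ = m`, `n₁ + n₂ = n`, and the ideal of maximal minors of `Aᵢ` is `Jᵢ`. -/
def IsDecomposable {m n : ℕ} (A : Matrix (Fin m) (Fin n) R) (J₁ J₂ : Ideal R) : Prop :=
  ∃ (m₁ m₂ n₁ n₂ : ℕ) (e : Fin m₁ ⊕ Fin m₂ ≃ Fin m) (e' : Fin n₁ ⊕ Fin n₂ ≃ Fin n)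
    (A₁ : Matrix (Fin m₁) (Fin n₁) R) (A₂ : Matrix (Fin m₂) (Fin n₂) R),
    minorsIdeal m₁ A₁ = J₁ ∧ minorsIdeal m₂ A₂ = J₂ ∧
      LREquiv A (Matrix.reindex e e' (Matrix.fromBlocks A₁ 0 0 A₂))

/-- The square matrix `A` is completely decomposable along the hypersurfaces `{f i = 0}`: it is
equivalent to a block diagonal matrix with one square block `B i` for every hypersurface, where
`det (B i)` is an equation of the `i`-th hypersurface. -/
def IsCompletelyDecomposable {m r : ℕ} (A : Matrix (Fin m) (Fin m) R) (f : Fin r → R) : Prop :=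
  ∃ (d : Fin r → ℕ) (B : ∀ i, Matrix (Fin (d i)) (Fin (d i)) R)
    (e : (Σ i, Fin (d i)) ≃ Fin m),
    (∀ i, Ideal.span {(B i).det} = Ideal.span {f i}) ∧
      LREquiv A (Matrix.reindex e e (Matrix.blockDiagonal' B))

/-- The rank of the matrix `A` evaluated at the point `x` of `Spec R`, i.e. over the residue
field of `x`. -/
noncomputable def rankAt {m n : ℕ} (A : Matrix (Fin m) (Fin n) R) (x : PrimeSpectrum R) : ℕ :=
  (A.map (algebraMap R x.asIdeal.ResidueField)).rank

/-- The total space `{(x, z) : x ∈ X, A(x) z = 0}` of the family of kernels of `A` over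
`X = V(J)`, as a closed subset of the affine space `Spec R × 𝔸ⁿ = Spec R[z₁, …, zₙ]`. -/
def kernelSpace {m n : ℕ} (A : Matrix (Fin m) (Fin n) R) (J : Ideal R) :
    Set (PrimeSpectrum (MvPolynomial (Fin n) R)) :=
  {q | (∀ a ∈ J, MvPolynomial.C a ∈ q.asIdeal) ∧
    ∀ i, ∑ j, MvPolynomial.C (A i j) * MvPolynomial.X j ∈ q.asIdeal}

/-- The largest open subset `Y` of the (reduced) locus `X = V(J)` over which the kernels of `A`
form an embedded vector bundle, i.e. over which the rank of `A(x)` is locally constant. -/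
def bundleLocus {m n : ℕ} (A : Matrix (Fin m) (Fin n) R) (J : Ideal R) :
    Set (PrimeSpectrum R) :=
  {x | x ∈ PrimeSpectrum.zeroLocus (J : Set R) ∧
    ∃ W : Set (PrimeSpectrum R), IsOpen W ∧ x ∈ W ∧
      ∀ y ∈ W ∩ PrimeSpectrum.zeroLocus (J : Set R), rankAt A y = rankAt A x}

/-- The total space of the embedded vector bundle of kernels of `A` over `bundleLocus A J`. -/
def kernelBundle {m n : ℕ} (A : Matrix (Fin m) (Fin n) R) (J : Ideal R) :
    Set (PrimeSpectrum (MvPolynomial (Fin n) R)) :=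
  kernelSpace A J ∩ PrimeSpectrum.comap MvPolynomial.C ⁻¹' bundleLocus A J

end Matrices

section Fibres

variable {k : Type*} [Field k] {R : Type*} [CommRing R] [IsLocalRing R] [Algebra k R]

/-- The point `(0, v)` of `Spec R × 𝔸ⁿ = Spec R[z₁, …, zₙ]`, where `0` is the closed point of
`Spec R` and `v ∈ kⁿ`: the prime ideal of all polynomials `P` whose reduction modulo the maximal
ideal vanishes at `v`. -/
noncomputable def originPoint (R : Type*) [CommRing R] [IsLocalRing R] [Algebra k R]
    {n : ℕ} (v : Fin n → k) : PrimeSpectrum (MvPolynomial (Fin n) R) :=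
  ⟨RingHom.ker (MvPolynomial.eval₂Hom (residue R)
    (fun j => algebraMap k (ResidueField R) (v j))), RingHom.ker_isPrime _⟩

/-- The span in `kⁿ` of the fibre at the origin of the closure of the bundle of kernels of `A`
over `V(J)`. -/
noncomputable def limitSpan (k : Type*) [Field k] [Algebra k R] {m n : ℕ}
    (A : Matrix (Fin m) (Fin n) R) (J : Ideal R) : Submodule k (Fin n → k) :=
  Submodule.span k {v | originPoint R v ∈ closure (kernelBundle A J)}

end Fibres

end KernelFibres

/-!
# Decomposability and limits of kernel fibres

**Decomposable matrices have independent limits.** Bring `A` to the form `A₁ ⊕ A₂`. If `Aᵢ` had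
more columns than rows, Cramer's rule would place its maximal minors into `J₁ J₂`, against
Nakayama's lemma (`minorsIdeal_le_of_lt`; McCoy's theorem `eq_zero_of_mul_minors_eq_zero` excludes
`I_m(A) = 0`). So both blocks are square, and `J₁ ∩ J₂ = J₁ J₂` says that their determinants are
regular modulo each other. Hence `det A₂` vanishes nowhere on the locus where the rank of `A` is
locally constant on `V(J₁)`: a point of `{det A₁ = det A₂ = 0}` is a specialization of a point
of `{det A₁ = 0}` of larger rank (`det_notMem_of_mem_bundleLocus`). The kernel bundle over `V(J₁)`
thus lies in the coordinate subspace of the first block, and so do its limits.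

**Independent limits give a diagonal form.** In the regular local ring `R` the product of the `f i`
has order exactly `r`, while `det A ∈ 𝔪ᵐ`, so `m ≤ r`. All the `V i` are nonzero (which comes
out of the argument below), so their independence in `kᵐ` gives `r = m` and makes every `V i` a
line. The point is to lift
the line `V i` to a kernel vector of `A` over the whole hypersurface `S = R / (f i)`. Let
`v ∈ Sᵐ` be any nonzero kernel vector, in coordinates in which `V i` is a coordinate axis, and let
`I` be the ideal generated by the `v j`. The other coordinate functions vanish on the fibre of the
closure at the origin, so by the Nullstellensatz a power `v j ^ N` lies in `𝔪 I ^ N`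
(`exists_pow_mem_of_forall_limitSpan`). Nakayama's lemma then makes the remaining coordinate `v i`
generate a reduction of `I`, so that `v j / v i` is almost integral over `S`. As `S` is regular,
hence completely integrally closed, `v i` divides every `v j` (`exists_eq_mul_of_pow_mem`), and
`v / v i` is the wanted kernel vector. The matrix `W` of the lifted vectors is invertible, and
`A W = N * diagonal f`; comparison of determinants shows that `N` is invertible, so `A` is
equivalent to `diagonal f`.

That a regular local `k`-algebra with residue field `k` is a completely integrally closed domain
is proved through initial forms: by Krull's height theorem no nonzero form of degree `n` takes a
value in `𝔪ⁿ⁺¹` at a regular system of parameters (`IsRegularSystem.eq_zero_of_aeval_mem`), so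
that divisibility can be tested in the polynomial ring over `k`, up to powers of `𝔪`.
-/

namespace KernelFibres

open IsLocalRing

/-! ### Initial forms with respect to a regular system of parameters -/

section InitialForms

open MvPolynomial

/-- The value of a form of degree `n` with coefficients in `J` at a point with coordinates in
`I`. -/
theorem eval_mem_mul_pow {ι S : Type*} [CommRing S] {I J : Ideal S} {v : ι → S}
    (hv : ∀ j, v j ∈ I) {n : ℕ} {P : MvPolynomial ι S} (hP : P.IsHomogeneous n)
    (hc : ∀ α, P.coeff α ∈ J) : eval v P ∈ J * I ^ n := by
  rw [eval_eq]
  refine Ideal.sum_mem _ fun α hα => Ideal.mul_mem_mul (hc α) ?_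
  have hdeg : ∑ j ∈ α.support, α j = n := by
    rw [← hP.degree_eq_sum_deg_support hα]
  rw [← hdeg, ← Finset.prod_pow_eq_pow_sum]
  exact Ideal.prod_mem_prod fun j _ => Ideal.pow_mem_pow (hv j) _

theorem aeval_algebraMap_mul {ι k S : Type*} [Field k] [CommRing S] [Algebra k S] {n : ℕ}
    {F : MvPolynomial ι k} (hF : F.IsHomogeneous n) (c : ι → k) (y : S) :
    aeval (fun j => algebraMap k S (c j) * y) F = algebraMap k S (eval c F) * y ^ n := by
  rw [aeval_def, eval₂_eq, eval_eq, map_sum, Finset.sum_mul]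
  refine Finset.sum_congr rfl fun α hα => ?_
  have hdeg : ∑ j ∈ α.support, α j = n := by
    rw [← hF.degree_eq_sum_deg_support hα]
  simp only [mul_pow, Finset.prod_mul_distrib, map_mul, map_prod, map_pow]
  rw [Finset.prod_pow_eq_pow_sum, hdeg, mul_assoc]

/-- An integrally closed Noetherian domain is completely integrally closed. -/
theorem dvd_of_forall_pow_dvd_mul_pow {A : Type*} [CommRing A] [IsDomain A] [IsNoetherianRing A]
    [IsIntegrallyClosed A] {F G H : A} (hG : G ≠ 0) (hH : H ≠ 0)
    (h : ∀ s, G ^ s ∣ H * F ^ s) : G ∣ F := by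
  have hG' : algebraMap A (FractionRing A) G ≠ 0 := by simpa using hG
  have hint : IsIntegral A (algebraMap A (FractionRing A) F / algebraMap A (FractionRing A) G) := by
    refine IsAlmostIntegral.isIntegral ⟨H, mem_nonZeroDivisors_of_ne_zero hH, fun s => ?_⟩
    obtain ⟨T, hT⟩ := h s
    refine ⟨T, ?_⟩
    rw [Algebra.smul_def, div_pow, ← mul_div_assoc, eq_div_iff (pow_ne_zero s hG'), ← map_pow,
      ← map_pow, ← map_mul, ← map_mul, hT, mul_comm]
  obtain ⟨q, hq⟩ := IsIntegrallyClosed.isIntegral_iff.mp hint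
  refine ⟨q, IsFractionRing.injective A (FractionRing A) ?_⟩
  rw [map_mul, hq, mul_div_cancel₀ _ hG']

theorem exists_isHomogeneous_eq_mul_of_dvd {k : Type*} [Field k] {d n e : ℕ}
    {F G : MvPolynomial (Fin d) k}
    (hF : F.IsHomogeneous n) (hG : G.IsHomogeneous e) (hF0 : F ≠ 0) (h : G ∣ F) :
    ∃ (m : ℕ) (Q : MvPolynomial (Fin d) k), e + m = n ∧ Q.IsHomogeneous m ∧ F = G * Q := by
  obtain ⟨Q, rfl⟩ := h
  have hQ0 : Q ≠ 0 := right_ne_zero_of_mul hF0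
  have hG0 : G ≠ 0 := left_ne_zero_of_mul hF0
  obtain ⟨m, hm⟩ : ∃ m, homogeneousComponent m Q ≠ 0 := by
    by_contra! hall
    apply hQ0
    rw [← sum_homogeneousComponent Q, Finset.sum_eq_zero fun i _ => hall i]
  have hcomp : homogeneousComponent (e + m) (G * Q) = G * homogeneousComponent m Q := by
    let : GradedAlgebra (homogeneousSubmodule (Fin d) k) := gradedAlgebra
    have := DirectSum.coe_decompose_mul_add_of_left_mem (homogeneousSubmodule (Fin d) k)
      (a := G) (b := Q) (i := e) (j := m) hG
    exact (decomposition.decompose'_apply _ _).symm.trans (this.trans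
      (congrArg (G * ·) (decomposition.decompose'_apply _ _)))
  have hne : homogeneousComponent (e + m) (G * Q) ≠ 0 := hcomp ▸ mul_ne_zero hG0 hm
  rw [homogeneousComponent_of_mem hF] at hcomp hne
  have hn : e + m = n := by
    by_contra h
    exact hne (if_neg h)
  rw [if_pos hn] at hcomp
  exact ⟨m, homogeneousComponent m Q, hn, homogeneousComponent_isHomogeneous _ _, hcomp⟩

variable {k S : Type*} [Field k] [CommRing S] [IsLocalRing S] [Algebra k S]

theorem algHom_apply_eq_zero_iff (π : S →ₐ[k] k) {a : S} : π a = 0 ↔ a ∈ maximalIdeal S := by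
  have hsurj : Function.Surjective π := fun c => ⟨algebraMap k S c, by simp⟩
  have : (RingHom.ker π).IsMaximal := RingHom.ker_isMaximal_of_surjective π hsurj
  rw [← IsLocalRing.eq_maximalIdeal this, RingHom.mem_ker]

/-- A generating family `x` of the maximal ideal whose length is at most (hence equal to) the
dimension: a regular system of parameters. -/
structure IsRegularSystem {d : ℕ} (x : Fin d → S) : Prop where
  span_range : Ideal.span (Set.range x) = maximalIdeal S
  le_dim : (d : WithBot ℕ∞) ≤ ringKrullDim S

/-- `F` is the degree `n` initial form of `a`: a form of degree `n` with
`a ≡ F(x) mod 𝔪ⁿ⁺¹`. The form `F` may be zero, namely when `a ∈ 𝔪ⁿ⁺¹`. -/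
def IsInitialForm {d : ℕ} (x : Fin d → S) (n : ℕ) (F : MvPolynomial (Fin d) k) (a : S) : Prop :=
  F.IsHomogeneous n ∧ a - aeval x F ∈ maximalIdeal S ^ (n + 1)

variable {d : ℕ} {x : Fin d → S}

theorem aeval_mem_pow (hx : Ideal.span (Set.range x) = maximalIdeal S) {n : ℕ}
    {F : MvPolynomial (Fin d) k} (hF : F.IsHomogeneous n) : aeval x F ∈ maximalIdeal S ^ n := by
  rw [← hx, Ideal.mem_span_pow_iff_exists_isHomogeneous]
  exact ⟨map (algebraMap k S) F, hF.map _, by rw [eval_map, aeval_def]⟩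

/-- A nonzero form of degree `n` over the residue field does not take a value in `𝔪ⁿ⁺¹` at a
regular system of parameters. Otherwise pick a point `c` with `F(c) ≠ 0` and `c l ≠ 0`; modulo
the `d - 1` elements `x j - (c j / c l) * x l` the maximal ideal becomes nilpotent, against Krull's height
theorem. -/
theorem IsRegularSystem.eq_zero_of_aeval_mem [IsNoetherianRing S] [Infinite k]
    (hx : IsRegularSystem x) {n : ℕ} {F : MvPolynomial (Fin d) k} (hF : F.IsHomogeneous n)
    (h : aeval x F ∈ maximalIdeal S ^ (n + 1)) : F = 0 := by
  classical
  by_contra hne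
  obtain ⟨c, hc⟩ : ∃ c, eval c F ≠ 0 := by
    by_contra! hall
    exact hne (hF.eq_zero_of_forall_eval_eq_zero hall)
  have hnonunit : ∀ {u : k}, u ≠ 0 → ∀ {z : S}, z ∈ maximalIdeal S →
      IsUnit (algebraMap k S u - z) := fun {u} hu z hz => by
    by_contra hnu
    have h1 : algebraMap k S u - z ∈ maximalIdeal S := hnu
    have h2 := Ideal.add_mem _ h1 hz
    rw [sub_add_cancel] at h2
    exact h2 ((IsUnit.mk0 u hu).map (algebraMap k S))
  rcases Nat.eq_zero_or_pos n with rfl | hn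
  · obtain ⟨a, rfl⟩ : ∃ a, F = C a := by
      refine ⟨_, totalDegree_eq_zero_iff_eq_C.mp (Nat.le_zero.mp hF.totalDegree_le)⟩
    rw [eval_C] at hc
    have := hnonunit hc (Ideal.zero_mem _)
    rw [sub_zero] at this
    rw [aeval_C, zero_add, pow_one] at h
    exact h this
  obtain ⟨l, hl⟩ : ∃ l, c l ≠ 0 := by
    by_contra! hall
    apply hc
    have := aeval_algebraMap_mul (S := k) hF c 0
    simp only [mul_zero] at this
    have hc0 : c = fun _ => 0 := funext hall
    rw [zero_pow hn.ne', mul_zero, ← hc0, aeval_eq_eval] at this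
    exact this
  -- Normalize the `l`-th coordinate of the point to `1`.
  set c' : Fin d → k := fun j => c j / c l
  have hc' : eval c' F ≠ 0 := by
    intro h0
    apply hc
    have := aeval_algebraMap_mul (S := k) hF c' (c l)
    rw [h0, map_zero, zero_mul] at this
    rw [← this, aeval_eq_eval]
    congr 2
    funext j
    simp [c', hl]
  set T : Finset S := (Finset.univ.erase l).image (fun j => x j - algebraMap k S (c' j) * x l)
  have hTcard : T.card < d := by
    refine Finset.card_image_le.trans_lt ?_
    rw [Finset.card_erase_of_mem (Finset.mem_univ l), Finset.card_univ, Fintype.card_fin]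
    have := l.pos
    omega
  set I : Ideal S := Ideal.span (T : Set S)
  have hxm : ∀ j, x j ∈ maximalIdeal S := fun j => hx.span_range ▸ Ideal.subset_span ⟨j, rfl⟩
  have hcl : c' l = 1 := by simp [c', hl]
  have hπ : ∀ j, Ideal.Quotient.mk I (x j)
      = algebraMap k (S ⧸ I) (c' j) * Ideal.Quotient.mk I (x l) := by
    intro j
    by_cases hj : j = l
    · rw [hj, hcl, map_one, one_mul]
    · have : x j - algebraMap k S (c' j) * x l ∈ I :=
        Ideal.subset_span (by simpa [T] using ⟨j, hj, rfl⟩)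
      have h2 := (Ideal.Quotient.eq (I := I)).mpr this
      rw [h2, map_mul]
      rfl
  have hval : Ideal.Quotient.mk I (aeval x F)
      = algebraMap k (S ⧸ I) (eval c' F) * Ideal.Quotient.mk I (x l) ^ n := by
    rw [← aeval_algebraMap_mul hF]
    rw [show (fun j => algebraMap k (S ⧸ I) (c' j) * Ideal.Quotient.mk I (x l))
      = fun j => Ideal.Quotient.mkₐ k I (x j) from funext fun j => (hπ j).symm]
    exact comp_aeval_apply _ (Ideal.Quotient.mkₐ k I) F
  have hmap : (maximalIdeal S).map (Ideal.Quotient.mk I)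
      ≤ Ideal.span {Ideal.Quotient.mk I (x l)} := by
    rw [← hx.span_range, Ideal.map_span, Ideal.span_le]
    rintro _ ⟨_, ⟨j, rfl⟩, rfl⟩
    rw [hπ j]
    exact Ideal.mul_mem_left _ _ (Ideal.mem_span_singleton_self _)
  have hpow := Ideal.mem_map_of_mem (Ideal.Quotient.mk I) h
  rw [Ideal.map_pow] at hpow
  replace hpow := Ideal.pow_right_mono hmap _ hpow
  rw [Ideal.span_singleton_pow, Ideal.mem_span_singleton'] at hpow
  obtain ⟨b, hb⟩ := hpow
  obtain ⟨b, rfl⟩ := Ideal.Quotient.mk_surjective b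
  -- Modulo `I`, the value `F(x)` is a unit times `x l ^ n` and a multiple of `x l ^ (n + 1)`.
  have hxl : x l ^ n ∈ I := by
    have hu := hnonunit hc' (Ideal.mul_mem_left _ b (hxm l))
    have : (algebraMap k S (eval c' F) - b * x l) * x l ^ n ∈ I := by
      rw [← Ideal.Quotient.eq_zero_iff_mem, map_mul, map_sub, map_mul, map_pow, sub_mul]
      rw [show Ideal.Quotient.mk I (algebraMap k S (eval c' F))
        = algebraMap k (S ⧸ I) (eval c' F) from rfl, ← hval, ← hb]
      ring
    exact (Ideal.unit_mul_mem_iff_mem I hu).mp this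
  have hTm : I ≤ maximalIdeal S := by
    rw [Ideal.span_le]
    intro t ht
    obtain ⟨j, -, rfl⟩ := Finset.mem_image.mp (Finset.mem_coe.mp ht)
    exact Ideal.sub_mem _ (hxm j) (Ideal.mul_mem_left _ _ (hxm l))
  have hmin : maximalIdeal S ∈ I.minimalPrimes := by
    refine ⟨⟨inferInstance, hTm⟩, fun P hP _ => ?_⟩
    have hPp := hP.1
    have hxlP : x l ∈ P := hPp.mem_of_pow_mem n (hP.2 hxl)
    rw [← hx.span_range, Ideal.span_le]
    rintro _ ⟨j, rfl⟩
    by_cases hj : j = l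
    · exact hj ▸ hxlP
    · have : x j - algebraMap k S (c' j) * x l ∈ P :=
        hP.2 (Ideal.subset_span (by simpa [T] using ⟨j, hj, rfl⟩))
      simpa using Ideal.add_mem _ this (Ideal.mul_mem_left _ (algebraMap k S (c' j)) hxlP)
  have h1 := Ideal.height_le_card_of_mem_minimalPrimes_span_finset hmin
  have h2 := hx.le_dim
  rw [← maximalIdeal_height_eq_ringKrullDim] at h2
  have h3 : (d : ℕ∞) ≤ (maximalIdeal S).height := by exact_mod_cast h2
  have h4 := h3.trans h1
  exact absurd (by exact_mod_cast h4 : d ≤ T.card) (by omega)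

theorem exists_isInitialForm (π : S →ₐ[k] k) (hx : Ideal.span (Set.range x) = maximalIdeal S)
    {n : ℕ} {a : S} (ha : a ∈ maximalIdeal S ^ n) :
    ∃ F : MvPolynomial (Fin d) k, IsInitialForm x n F a := by
  have ha' := ha
  rw [← hx, Ideal.mem_span_pow_iff_exists_isHomogeneous] at ha'
  obtain ⟨p, hp, rfl⟩ := ha'
  refine ⟨map (π : S →+* k) p, hp.map _, ?_⟩
  have hxm : ∀ j, x j ∈ maximalIdeal S := fun j => hx ▸ Ideal.subset_span ⟨j, rfl⟩
  rw [aeval_def, ← eval_map, ← map_sub, pow_succ']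
  refine eval_mem_mul_pow hxm (hp.sub ((hp.map _).map _)) fun α => ?_
  rw [coeff_sub, coeff_map, coeff_map, ← algHom_apply_eq_zero_iff π]
  simp

theorem IsInitialForm.mem_pow (hx : Ideal.span (Set.range x) = maximalIdeal S) {n : ℕ}
    {F : MvPolynomial (Fin d) k} {a : S} (h : IsInitialForm x n F a) : a ∈ maximalIdeal S ^ n := by
  have := Ideal.add_mem _ (Ideal.pow_le_pow_right (Nat.le_succ n) h.2) (aeval_mem_pow hx h.1)
  rwa [sub_add_cancel] at this

theorem IsInitialForm.mul (hx : Ideal.span (Set.range x) = maximalIdeal S) {n p : ℕ}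
    {F G : MvPolynomial (Fin d) k} {a b : S} (hF : IsInitialForm x n F a)
    (hG : IsInitialForm x p G b) : IsInitialForm x (n + p) (F * G) (a * b) := by
  refine ⟨hF.1.mul hG.1, ?_⟩
  have e : a * b - aeval x (F * G) = a * (b - aeval x G) + (a - aeval x F) * aeval x G := by
    rw [map_mul]; ring
  rw [e]
  refine Ideal.add_mem _ ?_ ?_
  · rw [show n + p + 1 = n + (p + 1) by ring, pow_add]
    exact Ideal.mul_mem_mul (hF.mem_pow hx) hG.2
  · rw [show n + p + 1 = (n + 1) + p by ring, pow_add]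
    exact Ideal.mul_mem_mul hF.2 (aeval_mem_pow hx hG.1)

theorem IsInitialForm.pow (hx : Ideal.span (Set.range x) = maximalIdeal S) {n : ℕ}
    {F : MvPolynomial (Fin d) k} {a : S} (hF : IsInitialForm x n F a) (s : ℕ) :
    IsInitialForm x (n * s) (F ^ s) (a ^ s) := by
  induction s with
  | zero => exact ⟨by simpa using isHomogeneous_one _ _, by simp⟩
  | succ s ih => rw [pow_succ, pow_succ, Nat.mul_succ]; exact ih.mul hx hF

theorem IsInitialForm.prod (hx : Ideal.span (Set.range x) = maximalIdeal S) {ι : Type*}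
    (s : Finset ι) {F : ι → MvPolynomial (Fin d) k} {a : ι → S}
    (h : ∀ i, IsInitialForm x 1 (F i) (a i)) :
    IsInitialForm x s.card (∏ i ∈ s, F i) (∏ i ∈ s, a i) := by
  classical
  induction s using Finset.induction_on with
  | empty => exact ⟨by simpa using isHomogeneous_one _ _, by simp⟩
  | insert i s hi ih =>
    rw [Finset.prod_insert hi, Finset.prod_insert hi, Finset.card_insert_of_notMem hi, add_comm]
    exact (h i).mul hx ih

section Regular

variable [IsNoetherianRing S]

theorem exists_isInitialForm_ne_zero (hx : Ideal.span (Set.range x) = maximalIdeal S)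
    (π : S →ₐ[k] k) {a : S}
    (ha : a ≠ 0) : ∃ (n : ℕ) (F : MvPolynomial (Fin d) k), F ≠ 0 ∧ IsInitialForm x n F a := by
  classical
  have hex : ∃ n, a ∉ maximalIdeal S ^ n := by
    by_contra! hall
    apply ha
    have := Ideal.iInf_pow_eq_bot_of_isLocalRing (maximalIdeal S) (Ideal.IsPrime.ne_top')
    rw [← Ideal.mem_bot, ← this]
    exact Ideal.mem_iInf.mpr hall
  obtain ⟨n, hn⟩ : ∃ n, Nat.find hex = n + 1 := by
    refine Nat.exists_eq_succ_of_ne_zero fun h0 => ?_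
    have := Nat.find_spec hex
    rw [h0] at this
    simp at this
  have h1 := Nat.find_spec hex
  rw [hn] at h1
  have h2 : a ∈ maximalIdeal S ^ n := not_not.mp (Nat.find_min hex (by omega))
  obtain ⟨F, hF⟩ := exists_isInitialForm π hx h2
  refine ⟨n, F, fun h0 => h1 ?_, hF⟩
  simpa [h0] using hF.2

variable [Infinite k]

theorem IsRegularSystem.isInitialForm_eq_zero (hx : IsRegularSystem x) {n : ℕ}
    {F : MvPolynomial (Fin d) k} {a : S} (hF : IsInitialForm x n F a)
    (ha : a ∈ maximalIdeal S ^ (n + 1)) : F = 0 := by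
  refine hx.eq_zero_of_aeval_mem hF.1 ?_
  have := Ideal.sub_mem _ ha hF.2
  rwa [sub_sub_cancel] at this

theorem IsRegularSystem.isInitialForm_unique (hx : IsRegularSystem x) {n p : ℕ}
    {F G : MvPolynomial (Fin d) k} {a : S} (hF : IsInitialForm x n F a) (hF0 : F ≠ 0)
    (hG : IsInitialForm x p G a) (hG0 : G ≠ 0) : n = p ∧ F = G := by
  have aux : ∀ {n p : ℕ} {F G : MvPolynomial (Fin d) k}, IsInitialForm x n F a → F ≠ 0 →
      IsInitialForm x p G a → p ≤ n := fun {n p F G} hF hF0 hG => by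
    by_contra! hlt
    exact hF0 (hx.isInitialForm_eq_zero hF
      (Ideal.pow_le_pow_right hlt (hG.mem_pow hx.span_range)))
  obtain rfl : n = p := le_antisymm (aux hG hG0 hF) (aux hF hF0 hG)
  refine ⟨rfl, sub_eq_zero.mp (hx.eq_zero_of_aeval_mem (hF.1.sub hG.1) ?_)⟩
  have := Ideal.sub_mem _ hG.2 hF.2
  rwa [sub_sub_sub_cancel_left, ← map_sub] at this

theorem IsRegularSystem.isDomain (hx : IsRegularSystem x) (π : S →ₐ[k] k) : IsDomain S := by
  have : NoZeroDivisors S := ⟨fun {a b} hab => by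
    by_contra! h
    obtain ⟨n, F, hF0, hF⟩ := exists_isInitialForm_ne_zero hx.span_range π h.1
    obtain ⟨p, G, hG0, hG⟩ := exists_isInitialForm_ne_zero hx.span_range π h.2
    refine mul_ne_zero hF0 hG0 (hx.isInitialForm_eq_zero (hF.mul hx.span_range hG) ?_)
    rw [hab]
    exact Ideal.zero_mem _⟩
  exact NoZeroDivisors.to_isDomain S

/-- The order of a product of `r` elements of `𝔪 \ 𝔪²` is exactly `r`. -/
theorem IsRegularSystem.prod_notMem_pow (hx : IsRegularSystem x) (π : S →ₐ[k] k) {ι : Type*}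
    [Fintype ι] {f : ι → S} (hf : ∀ i, f i ∈ maximalIdeal S ∧ f i ∉ maximalIdeal S ^ 2) :
    ∏ i, f i ∉ maximalIdeal S ^ (Fintype.card ι + 1) := by
  intro h
  have hF : ∀ i, ∃ F : MvPolynomial (Fin d) k, IsInitialForm x 1 F (f i) := fun i =>
    exists_isInitialForm π hx.span_range (by rw [pow_one]; exact (hf i).1)
  choose F hF using hF
  have h0 := hx.isInitialForm_eq_zero (IsInitialForm.prod hx.span_range Finset.univ hF) h
  obtain ⟨i, -, hi⟩ := Finset.prod_eq_zero_iff.mp h0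
  refine (hf i).2 ?_
  simpa [hi] using (hF i).2

/-- A ring with a regular system of parameters is completely integrally closed: dividing
successively by the initial form of `b`, which is possible in the polynomial ring over the residue
field, puts `a` into `(b) + 𝔪ⁿ` for all `n`. -/
theorem IsRegularSystem.dvd_of_forall_pow_dvd (hx : IsRegularSystem x) (π : S →ₐ[k] k)
    {a b c : S} (hb : b ≠ 0) (hc : c ≠ 0) (h : ∀ s, b ^ s ∣ c * a ^ s) : b ∣ a := by
  have := hx.isDomain π
  have key : ∀ n, ∃ q, a - b * q ∈ maximalIdeal S ^ n := by
    intro n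
    induction n with
    | zero => exact ⟨0, by simp⟩
    | succ n ih =>
      obtain ⟨q, hq⟩ := ih
      obtain ⟨F, hF⟩ := exists_isInitialForm π hx.span_range hq
      by_cases hF0 : F = 0
      · exact ⟨q, by simpa [hF0] using hF.2⟩
      obtain ⟨e, G, hG0, hG⟩ := exists_isInitialForm_ne_zero hx.span_range π hb
      obtain ⟨l, H, hH0, hH⟩ := exists_isInitialForm_ne_zero hx.span_range π hc
      have ha0 : a - b * q ≠ 0 := fun h0 => hF0 (hx.isInitialForm_eq_zero hF (by simp [h0]))
      -- The remainder is almost divisible by `b` with the same denominator `c`.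
      have h' : ∀ s, b ^ s ∣ c * (a - b * q) ^ s := fun s => by
        rw [sub_eq_add_neg, add_pow, Finset.mul_sum]
        refine Finset.dvd_sum fun i hi => ?_
        have hi' : i + (s - i) = s := by have := Finset.mem_range.mp hi; omega
        obtain ⟨t, ht⟩ := h i
        refine ⟨t * (-q) ^ (s - i) * (s.choose i : S), ?_⟩
        rw [show c * (a ^ i * (-(b * q)) ^ (s - i) * (s.choose i : S))
          = (c * a ^ i) * (b ^ (s - i) * (-q) ^ (s - i)) * (s.choose i : S) by
            rw [← mul_pow]; ring, ht]
        rw [← congrArg (b ^ ·) hi', pow_add]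
        ring
      have hdvd : G ∣ F := by
        refine dvd_of_forall_pow_dvd_mul_pow hG0 hH0 fun s => ?_
        obtain ⟨t, ht⟩ := h' s
        have ht0 : t ≠ 0 := by
          rintro rfl
          rw [mul_zero] at ht
          exact mul_ne_zero hc (pow_ne_zero s ha0) ht
        obtain ⟨u, T, hT0, hT⟩ := exists_isInitialForm_ne_zero hx.span_range π ht0
        have h1 := hH.mul hx.span_range (hF.pow hx.span_range s)
        have h2 := (hG.pow hx.span_range s).mul hx.span_range hT
        rw [ht] at h1
        exact ⟨T, (hx.isInitialForm_unique h1 (mul_ne_zero hH0 (pow_ne_zero s hF0)) h2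
          (mul_ne_zero (pow_ne_zero s hG0) hT0)).2⟩
      obtain ⟨m, Q, rfl, hQ, rfl⟩ := exists_isHomogeneous_eq_mul_of_dvd hF.1 hG.1 hF0 hdvd
      have hQ' : IsInitialForm x m Q (aeval x Q) := ⟨hQ, by simp⟩
      refine ⟨q + aeval x Q, ?_⟩
      have := Ideal.sub_mem _ hF.2 (hG.mul hx.span_range hQ').2
      rwa [sub_sub_sub_cancel_right, sub_sub, ← mul_add] at this
  -- Krull's intersection theorem in `S / (b)` concludes.
  by_cases hbu : IsUnit b
  · exact hbu.dvd
  have hB : Ideal.span {b} ≠ ⊤ := by rwa [Ne, Ideal.span_singleton_eq_top]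
  have : Nontrivial (S ⧸ Ideal.span {b}) := Ideal.Quotient.nontrivial_iff.mpr hB
  have : IsLocalRing (S ⧸ Ideal.span {b}) :=
    IsLocalRing.of_surjective' _ Ideal.Quotient.mk_surjective
  rw [← Ideal.mem_span_singleton, ← Ideal.Quotient.eq_zero_iff_mem, ← Ideal.mem_bot,
    ← Ideal.iInf_pow_eq_bot_of_isLocalRing _
      (Ideal.IsPrime.ne_top' (I := maximalIdeal (S ⧸ Ideal.span {b})))]
  refine Ideal.mem_iInf.mpr fun n => ?_
  obtain ⟨q, hq⟩ := key n
  have h1 := Ideal.mem_map_of_mem (Ideal.Quotient.mk (Ideal.span {b})) hq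
  rw [Ideal.map_pow] at h1
  have h2 : Ideal.Quotient.mk (Ideal.span {b}) (a - b * q) = Ideal.Quotient.mk _ a := by
    rw [Ideal.Quotient.eq, sub_sub_cancel_left, Ideal.neg_mem_iff, Ideal.mem_span_singleton]
    exact dvd_mul_right b q
  rw [h2] at h1
  refine Ideal.pow_right_mono ?_ n h1
  rw [Ideal.map_le_iff_le_comap]
  exact (IsLocalRing.eq_maximalIdeal (Ideal.comap_isMaximal_of_surjective _
    Ideal.Quotient.mk_surjective)).ge

end Regular

section Existence

theorem exists_isRegularSystem (R : Type*) [CommRing R] [IsRegularLocalRing R] :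
    ∃ (d : ℕ) (x : Fin d → R), IsRegularSystem x := by
  have hfg : (maximalIdeal R).FG := IsNoetherian.noetherian _
  have hfin := Submodule.FG.finite_generators hfg
  have hcard := Submodule.FG.generators_ncard hfg
  have := hfin.fintype
  let e := (Fintype.equivFin (maximalIdeal R).generators).symm
  refine ⟨_, fun i => (e i : R), ?_, ?_⟩
  · rw [show (fun i => (e i : R)) = Subtype.val ∘ e from rfl, Set.range_comp, e.range_eq_univ,
      Set.image_univ, Subtype.range_coe]
    exact Submodule.span_generators _
  · rw [← IsRegularLocalRing.spanFinrank_maximalIdeal, ← hcard, Set.ncard_eq_toFinset_card',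
      Set.toFinset_card]

/-- Dividing out an element of `𝔪 \ 𝔪²` leaves a ring with a regular system of parameters: some
`x l` is redundant modulo `f`, and the dimension drops by at most one. -/
theorem IsRegularSystem.quotient {R : Type*} [CommRing R] [IsLocalRing R] [IsNoetherianRing R]
    {d : ℕ} {x : Fin d → R} (hx : IsRegularSystem x) {f : R} (hf : f ∈ maximalIdeal R)
    (hf2 : f ∉ maximalIdeal R ^ 2) [IsLocalRing (R ⧸ Ideal.span {f})] :
    ∃ (e : ℕ) (y : Fin e → R ⧸ Ideal.span {f}), IsRegularSystem y := by
  have hxm : ∀ j, x j ∈ maximalIdeal R := fun j => hx.span_range ▸ Ideal.subset_span ⟨j, rfl⟩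
  obtain ⟨a, ha⟩ := Ideal.mem_span_range_iff_exists_fun.mp (hx.span_range ▸ hf)
  obtain ⟨l, hl⟩ : ∃ l, IsUnit (a l) := by
    by_contra! hall
    apply hf2
    rw [← ha, pow_two]
    exact Ideal.sum_mem _ fun i _ => Ideal.mul_mem_mul (hall i) (hxm i)
  obtain ⟨e, rfl⟩ : ∃ e, d = e + 1 := Nat.exists_eq_succ_of_ne_zero l.pos.ne'
  set mk := Ideal.Quotient.mk (Ideal.span {f})
  have hmax : (maximalIdeal R).map mk = maximalIdeal (R ⧸ Ideal.span {f}) := by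
    refine ((Ideal.map_eq_top_or_isMaximal_of_surjective mk Ideal.Quotient.mk_surjective
      (maximalIdeal.isMaximal R)).resolve_left fun h => ?_) |> IsLocalRing.eq_maximalIdeal
    have h1 := (Ideal.comap_map_of_surjective mk Ideal.Quotient.mk_surjective (maximalIdeal R))
    rw [h, Ideal.comap_top, ← RingHom.ker_eq_comap_bot, Ideal.mk_ker, sup_eq_left.mpr
      ((Ideal.span_singleton_le_iff_mem _).mpr hf)] at h1
    exact Ideal.IsPrime.ne_top' h1.symm
  refine ⟨e, fun j => mk (x (l.succAbove j)), ?_, ?_⟩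
  · rw [← hmax, ← hx.span_range, Ideal.map_span]
    refine le_antisymm (Ideal.span_mono ?_) ?_
    · rintro _ ⟨j, rfl⟩
      exact ⟨_, ⟨_, rfl⟩, rfl⟩
    · rw [Ideal.span_le]
      rintro _ ⟨_, ⟨j, rfl⟩, rfl⟩
      have hsub : ∀ j, mk (x (l.succAbove j)) ∈
          Ideal.span (Set.range fun j => mk (x (l.succAbove j))) :=
        fun j => Ideal.subset_span ⟨j, rfl⟩
      rcases Fin.eq_self_or_eq_succAbove l j with rfl | ⟨j, rfl⟩
      · have h0 : mk f = 0 := Ideal.Quotient.eq_zero_iff_mem.mpr (Ideal.mem_span_singleton_self f)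
        replace h0 := (congrArg mk ha).trans h0
        rw [Fin.sum_univ_succAbove _ j, map_add, map_sum, map_mul] at h0
        refine (Ideal.unit_mul_mem_iff_mem _ (hl.map mk)).mp ?_
        rw [eq_neg_of_add_eq_zero_left h0]
        refine Ideal.neg_mem_iff _ |>.mpr (Ideal.sum_mem _ fun i _ => ?_)
        rw [map_mul]
        exact Ideal.mul_mem_left _ _ (hsub i)
      · exact hsub j
  · have h1 := ringKrullDim_le_ringKrullDim_quotient_add_spanFinrank (Ideal.span {f})
      (by rw [IsLocalRing.ringJacobson_eq_maximalIdeal]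
          exact (Ideal.span_singleton_le_iff_mem _).mpr hf)
    have h2 : (Ideal.span {f}).spanFinrank ≤ 1 := by
      have := Submodule.spanFinrank_span_le_ncard_of_finite (R := R) (Set.finite_singleton f)
      rwa [Set.ncard_singleton] at this
    have h3 := hx.le_dim.trans h1
    have h4 : ((e + 1 : ℕ) : WithBot ℕ∞) ≤ ringKrullDim (R ⧸ Ideal.span {f}) + (1 : ℕ) :=
      h3.trans (by gcongr)
    rw [Nat.cast_add, Nat.cast_one] at h4
    generalize ringKrullDim (R ⧸ Ideal.span {f}) = D at h4 ⊢
    induction D using WithBot.recBotCoe with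
    | bot => simp at h4
    | coe D =>
      have h5 : (e : ℕ∞) + 1 ≤ D + 1 := by exact_mod_cast h4
      exact_mod_cast (ENat.add_le_add_iff_right ENat.one_ne_top).mp h5

end Existence

end InitialForms

/-! ### Reductions of an ideal generated by one coordinate -/

section IntegralDependence

/-- A finitely generated ideal is nilpotent in the fibre ring `⨁ Iⁿ / J Iⁿ` of the Rees algebra of
`I` as soon as its generators, placed in degree one, are. -/
theorem exists_pow_le_of_forall_mem {S ι : Type*} [CommRing S] {I J : Ideal S} {v : ι → S}
    (hv : ∀ j, v j ∈ I) (s : Finset ι) (h : ∀ j ∈ s, ∃ N, v j ^ N ∈ J * I ^ N) :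
    ∃ M, Ideal.span (v '' s) ^ (M + 1) ≤ J * I ^ (M + 1) := by
  classical
  have hle : ∀ s : Finset ι, Ideal.span (v '' s) ≤ I := fun s => by
    rw [Ideal.span_le]
    rintro _ ⟨j, -, rfl⟩
    exact hv j
  induction s using Finset.induction_on with
  | empty => exact ⟨0, by simp⟩
  | insert i s hi ih =>
    obtain ⟨M, hM⟩ := ih fun j hj => h j (Finset.mem_insert_of_mem hj)
    obtain ⟨N, hN⟩ := h i (Finset.mem_insert_self i s)
    have hN' : Ideal.span {v i} ^ N ≤ J * I ^ N := by
      rwa [Ideal.span_singleton_pow, Ideal.span_singleton_le_iff_mem]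
    have hi' : Ideal.span {v i} ≤ I := (Ideal.span_singleton_le_iff_mem _).mpr (hv i)
    refine ⟨M + N, ?_⟩
    rw [Finset.coe_insert, Set.image_insert_eq, Ideal.span_insert, ← Submodule.add_eq_sup, add_pow]
    rw [Ideal.sum_eq_sup]
    refine Finset.sup_le fun a ha => Ideal.mul_le_left.trans ?_
    rw [Finset.mem_range] at ha
    -- One of the two factors has reached the exponent at which it is absorbed by `J`.
    by_cases haN : N ≤ a
    · calc Ideal.span {v i} ^ a * Ideal.span (v '' s) ^ (M + N + 1 - a)
          = Ideal.span {v i} ^ N * (Ideal.span {v i} ^ (a - N) *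
              Ideal.span (v '' s) ^ (M + N + 1 - a)) := by
            rw [← mul_assoc, ← pow_add, Nat.add_sub_cancel' haN]
        _ ≤ (J * I ^ N) * (I ^ (a - N) * I ^ (M + N + 1 - a)) := by
            gcongr
            exact hle s
        _ = J * I ^ (M + N + 1) := by
            rw [mul_assoc, ← pow_add, ← pow_add]
            congr 2
            omega
    · calc Ideal.span {v i} ^ a * Ideal.span (v '' s) ^ (M + N + 1 - a)
          = Ideal.span {v i} ^ a * (Ideal.span (v '' s) ^ (M + 1) *
              Ideal.span (v '' s) ^ (N - a)) := by
            rw [← pow_add]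
            congr 2
            omega
        _ ≤ I ^ a * ((J * I ^ (M + 1)) * I ^ (N - a)) := by
            gcongr
            exact hle s
        _ = J * (I ^ a * I ^ (M + 1) * I ^ (N - a)) := by ring
        _ = J * I ^ (M + N + 1) := by
            rw [← pow_add, ← pow_add]
            congr 2
            omega

/-- If all coordinates of `v` but `v i` are nilpotent in the fibre ring of the Rees algebra of
`I = (v j)`, that ring is finite over the subring generated by `v i`, so that `v i` generates a
reduction of `I`; over a completely integrally closed domain it then generates `I`. -/
theorem exists_eq_mul_of_pow_mem {S ι : Type*} [CommRing S] [IsLocalRing S] [IsNoetherianRing S]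
    [IsDomain S] [Fintype ι]
    (hcic : ∀ a b c : S, b ≠ 0 → c ≠ 0 → (∀ s, b ^ s ∣ c * a ^ s) → b ∣ a)
    {v : ι → S} (hv : v ≠ 0) (i : ι)
    (h : ∀ j, j ≠ i → ∃ N, v j ^ N ∈ maximalIdeal S * Ideal.span (Set.range v) ^ N) :
    v i ≠ 0 ∧ ∀ j, ∃ c, v j = c * v i ∧ (j ≠ i → c ∈ maximalIdeal S) := by
  classical
  set I := Ideal.span (Set.range v)
  have hvI : ∀ j, v j ∈ I := fun j => Ideal.subset_span ⟨j, rfl⟩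
  obtain ⟨l, hl⟩ : ∃ l, v l ≠ 0 := Function.ne_iff.mp hv
  obtain ⟨M, hM⟩ := exists_pow_le_of_forall_mem hvI (Finset.univ.erase i)
    fun j hj => h j (Finset.ne_of_mem_erase hj)
  set K := Ideal.span (v '' (Finset.univ.erase i : Finset ι))
  have hKI : K ≤ I := Ideal.span_mono (Set.image_subset_range _ _)
  have hiI : Ideal.span {v i} ≤ I := (Ideal.span_singleton_le_iff_mem _).mpr (hvI i)
  have hI : I = Ideal.span {v i} + K := by
    rw [Submodule.add_eq_sup, ← Ideal.span_insert, ← Set.image_insert_eq, ← Finset.coe_insert,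
      Finset.insert_erase (Finset.mem_univ i), Finset.coe_univ, Set.image_univ]
  -- By Nakayama's lemma, `v i` generates a reduction of `I`.
  have hred : I ^ (M + 1) ≤ Ideal.span {v i} * I ^ M := by
    refine Submodule.le_of_le_smul_of_le_jacobson_bot (I := maximalIdeal S)
      (IsNoetherian.noetherian _) (maximalIdeal_le_jacobson _) ?_
    rw [smul_eq_mul]
    nth_rewrite 1 [hI]
    rw [add_pow, Ideal.sum_eq_sup]
    refine Finset.sup_le fun a ha => Ideal.mul_le_left.trans ?_
    rw [Finset.mem_range] at ha
    rcases Nat.eq_zero_or_pos a with rfl | ha0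
    · rw [pow_zero, one_mul, Nat.sub_zero]
      exact hM.trans le_sup_right
    · refine le_trans ?_ le_sup_left
      calc Ideal.span {v i} ^ a * K ^ (M + 1 - a)
          = Ideal.span {v i} * (Ideal.span {v i} ^ (a - 1) * K ^ (M + 1 - a)) := by
            rw [← mul_assoc, ← pow_succ', Nat.sub_add_cancel ha0]
        _ ≤ Ideal.span {v i} * (I ^ (a - 1) * I ^ (M + 1 - a)) := by gcongr
        _ = Ideal.span {v i} * I ^ M := by
            rw [← pow_add]
            congr 2
            omega
  have hi0 : v i ≠ 0 := by
    intro h0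
    have h1 := hred (Ideal.pow_mem_pow (hvI l) (M + 1))
    rw [h0, Ideal.span_singleton_zero, Ideal.bot_mul, Ideal.mem_bot] at h1
    exact hl (pow_eq_zero_iff (Nat.succ_ne_zero M) |>.mp h1)
  have hdvd : ∀ j, v i ∣ v j := by
    intro j
    -- The nonzero element `v l ^ M` of `I ^ M` is a common denominator of the powers of `v j / v i`.
    refine hcic (v j) (v i) (v l ^ M) hi0 (pow_ne_zero M hl) fun s => ?_
    have hs : Ideal.span {v j} ^ s * I ^ M ≤ Ideal.span {v i} ^ s * I ^ M := by
      induction s with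
      | zero => rfl
      | succ s ih =>
        calc Ideal.span {v j} ^ (s + 1) * I ^ M
            = Ideal.span {v j} ^ s * (Ideal.span {v j} * I ^ M) := by ring
          _ ≤ Ideal.span {v j} ^ s * (I * I ^ M) := by
              gcongr
              exact (Ideal.span_singleton_le_iff_mem _).mpr (hvI j)
          _ ≤ Ideal.span {v j} ^ s * (Ideal.span {v i} * I ^ M) := by
              rw [← pow_succ']
              gcongr
          _ = Ideal.span {v i} * (Ideal.span {v j} ^ s * I ^ M) := by ring
          _ ≤ Ideal.span {v i} * (Ideal.span {v i} ^ s * I ^ M) := by gcongr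
          _ = Ideal.span {v i} ^ (s + 1) * I ^ M := by ring
    rw [← Ideal.mem_span_singleton, ← Ideal.span_singleton_pow, mul_comm]
    exact Ideal.mul_le_left (J := I ^ M) (hs (Ideal.mul_mem_mul
      (Ideal.pow_mem_pow (Ideal.mem_span_singleton_self _) s) (Ideal.pow_mem_pow (hvI l) M)))
  refine ⟨hi0, fun j => ?_⟩
  obtain ⟨c, hc⟩ := hdvd j
  refine ⟨c, by rw [hc, mul_comm], fun hj => ?_⟩
  obtain ⟨N, hN⟩ := h j hj
  have hIi : I = Ideal.span {v i} := le_antisymm (Ideal.span_le.mpr (by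
    rintro _ ⟨j, rfl⟩
    exact Ideal.mem_span_singleton.mpr (hdvd j))) hiI
  rw [hIi, Ideal.span_singleton_pow, Ideal.mem_mul_span_singleton, hc] at hN
  obtain ⟨z, hz, hz'⟩ := hN
  rw [mul_pow, mul_comm, mul_right_inj' (pow_ne_zero N hi0)] at hz'
  rw [hz'] at hz
  exact Ideal.IsPrime.mem_of_pow_mem inferInstance N hz

end IntegralDependence

/-! ### Rank at a point of the spectrum -/

section Rank

theorem exists_linearIndependent_comp {K V ι : Type*} [Field K] [AddCommGroup V] [Module K V]
    [Finite ι] (v : ι → V) {t : ℕ} (ht : Module.finrank K (Submodule.span K (Set.range v)) = t) :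
    ∃ c : Fin t → ι, LinearIndependent K (v ∘ c) := by
  subst ht
  have : Module.Finite K (Submodule.span K (Set.range v)) :=
    Module.Finite.span_of_finite K (Set.finite_range v)
  obtain ⟨f, hf, -, hli⟩ := Submodule.exists_fun_fin_finrank_span_eq K (Set.range v)
  choose c hc using hf
  exact ⟨c, by rwa [show v ∘ c = f from funext hc]⟩

theorem exists_det_submatrix_ne_zero {K : Type*} [Field K] {m n : ℕ}
    (A : Matrix (Fin m) (Fin n) K) :
    ∃ (r : Fin A.rank → Fin m) (c : Fin A.rank → Fin n), (A.submatrix r c).det ≠ 0 := by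
  obtain ⟨c, hc⟩ := exists_linearIndependent_comp A.col (A.rank_eq_finrank_span_cols).symm
  have h1 : (A.submatrix id c).transpose.rank = A.rank := by
    rw [LinearIndependent.rank_matrix (M := (A.submatrix id c).transpose) hc, Fintype.card_fin]
  rw [Matrix.rank_transpose, Matrix.rank_eq_finrank_span_row] at h1
  obtain ⟨r, hr⟩ := exists_linearIndependent_comp (A.submatrix id c).row h1
  refine ⟨r, c, ?_⟩
  rw [← isUnit_iff_ne_zero, ← Matrix.isUnit_iff_isUnit_det]
  exact Matrix.linearIndependent_rows_iff_isUnit.mp hr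

variable {R : Type*} [CommRing R] {m n : ℕ}

theorem det_map_residueField_eq_zero_iff {t : ℕ} (B : Matrix (Fin t) (Fin t) R)
    (x : PrimeSpectrum R) :
    (B.map (algebraMap R x.asIdeal.ResidueField)).det = 0 ↔ B.det ∈ x.asIdeal := by
  rw [← Ideal.algebraMap_residueField_eq_zero (I := x.asIdeal), RingHom.map_det,
    RingHom.mapMatrix_apply]

theorem exists_minor_notMem (A : Matrix (Fin m) (Fin n) R) (x : PrimeSpectrum R) :
    ∃ (r : Fin (rankAt A x) → Fin m) (c : Fin (rankAt A x) → Fin n),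
      (A.submatrix r c).det ∉ x.asIdeal := by
  obtain ⟨r, c, h⟩ := exists_det_submatrix_ne_zero (A.map (algebraMap R x.asIdeal.ResidueField))
  refine ⟨r, c, ?_⟩
  rwa [Ne, Matrix.submatrix_map, det_map_residueField_eq_zero_iff] at h

theorem le_rankAt {A : Matrix (Fin m) (Fin n) R} {x : PrimeSpectrum R} {t : ℕ}
    {r : Fin t → Fin m} {c : Fin t → Fin n} (h : (A.submatrix r c).det ∉ x.asIdeal) :
    t ≤ rankAt A x := by
  rw [← det_map_residueField_eq_zero_iff, ← Matrix.submatrix_map] at h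
  have h1 := Matrix.rank_of_isUnit _
    ((Matrix.isUnit_iff_isUnit_det _).mpr (isUnit_iff_ne_zero.mpr h))
  rw [Fintype.card_fin] at h1
  rw [rankAt, ← h1]
  exact Matrix.rank_submatrix_le _ _ _

theorem rankAt_mono (A : Matrix (Fin m) (Fin n) R) {x y : PrimeSpectrum R}
    (h : x.asIdeal ≤ y.asIdeal) : rankAt A y ≤ rankAt A x := by
  obtain ⟨r, c, hrc⟩ := exists_minor_notMem A y
  exact le_rankAt fun hx => hrc (h hx)

/-- The generic point of an irreducible closed set lies in the bundle locus: the rank there is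
the largest one, and it is attained on an open set. -/
theorem mem_bundleLocus_self (A : Matrix (Fin m) (Fin n) R) (x : PrimeSpectrum R) :
    x ∈ bundleLocus A x.asIdeal := by
  obtain ⟨r, c, hrc⟩ := exists_minor_notMem A x
  refine ⟨(PrimeSpectrum.mem_zeroLocus _ _).mpr le_rfl,
    PrimeSpectrum.basicOpen (A.submatrix r c).det, PrimeSpectrum.isOpen_basicOpen, hrc, ?_⟩
  rintro y ⟨hy, hxy⟩
  exact le_antisymm (rankAt_mono A hxy) (le_rankAt hy)

end Rank

/-! ### Limits of kernel lines -/

section Limits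

open MvPolynomial

/-- The homomorphism `R[z₁, …, zₙ] → (R/𝔭)[t]`, `zⱼ ↦ vⱼ t`, that parametrizes the line spanned by
`v` over the integral closed set `V(𝔭)`. -/
noncomputable def lineHom {R : Type*} [CommRing R] {n : ℕ} {p : Ideal R} (v : Fin n → R ⧸ p) :
    MvPolynomial (Fin n) R →+* Polynomial (R ⧸ p) :=
  eval₂Hom (Polynomial.C.comp (Ideal.Quotient.mk p))
    (fun j => Polynomial.C (v j) * Polynomial.X)

/-- The pullback of `P` to the line spanned by `v` has the values at `v` of the homogeneous components
of `P` as its coefficients. -/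
theorem coeff_lineHom {R : Type*} [CommRing R] {n : ℕ} {p : Ideal R} (v : Fin n → R ⧸ p)
    (P : MvPolynomial (Fin n) R) (N : ℕ) :
    (lineHom v P).coeff N = eval v (map (Ideal.Quotient.mk p) (homogeneousComponent N P)) := by
  classical
  induction P using MvPolynomial.induction_on' with
  | add P Q hP hQ => simp only [map_add, Polynomial.coeff_add, hP, hQ]
  | monomial α a =>
    have h1 : lineHom v (monomial α a)
        = Polynomial.C (Ideal.Quotient.mk p a * ∏ j ∈ α.support, v j ^ α j)
          * Polynomial.X ^ α.degree := by
      rw [lineHom, coe_eval₂Hom, eval₂_monomial, Finsupp.prod]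
      simp only [mul_pow, Finset.prod_mul_distrib, Finset.prod_pow_eq_pow_sum, map_mul, map_prod,
        map_pow, RingHom.comp_apply, mul_assoc]
      rfl
    rw [h1, Polynomial.coeff_C_mul, Polynomial.coeff_X_pow,
      homogeneousComponent_of_mem (isHomogeneous_monomial a rfl)]
    split_ifs
    · rw [map_monomial, eval_monomial, mul_one, Finsupp.prod]
    · simp

/-- The generic point of the line spanned by `v` over `V(𝔭)`. -/
noncomputable def linePoint {R : Type*} [CommRing R] {n : ℕ} {p : Ideal R} [p.IsPrime]
    (v : Fin n → R ⧸ p) : PrimeSpectrum (MvPolynomial (Fin n) R) :=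
  ⟨RingHom.ker (lineHom v), RingHom.ker_isPrime _⟩

theorem linePoint_mem_kernelBundle {R : Type*} [CommRing R] {m n : ℕ} {p : Ideal R} [hp : p.IsPrime]
    (A : Matrix (Fin m) (Fin n) R) {v : Fin n → R ⧸ p}
    (hv : (A.map (Ideal.Quotient.mk p)).mulVec v = 0) : linePoint v ∈ kernelBundle A p := by
  have hC : ∀ a, lineHom v (C a) = Polynomial.C (Ideal.Quotient.mk p a) := fun a => by
    rw [lineHom, coe_eval₂Hom, eval₂_C]
    rfl
  refine ⟨⟨fun a ha => ?_, fun i => ?_⟩, ?_⟩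
  · change lineHom v (C a) = 0
    rw [hC, Ideal.Quotient.eq_zero_iff_mem.mpr ha, map_zero]
  · change lineHom v _ = 0
    have hX : ∀ j, lineHom v (X j) = Polynomial.C (v j) * Polynomial.X := fun j => by
      rw [lineHom, coe_eval₂Hom, eval₂_X]
    have hi := congrFun hv i
    simp only [Matrix.mulVec, dotProduct, Matrix.map_apply, Pi.zero_apply] at hi
    simp only [map_sum, map_mul, hC, hX]
    simp only [← mul_assoc, ← Finset.sum_mul, ← map_mul, ← map_sum, hi, map_zero, zero_mul]
  · have : PrimeSpectrum.comap C (linePoint v) = ⟨p, hp⟩ := by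
      ext a
      change lineHom v (C a) = 0 ↔ a ∈ p
      rw [hC, Polynomial.C_eq_zero, Ideal.Quotient.eq_zero_iff_mem]
    rw [Set.mem_preimage, this]
    exact mem_bundleLocus_self A ⟨p, hp⟩

variable {k R : Type*} [Field k] [CommRing R] [IsLocalRing R] [Algebra k R]

theorem exists_residue_algHom (hk : Function.Bijective (algebraMap k (ResidueField R))) :
    ∃ π : R →ₐ[k] k, ∀ a, algebraMap k (ResidueField R) (π a) = residue R a := by
  let e := AlgEquiv.ofBijective (Algebra.ofId k (ResidueField R)) hk
  refine ⟨e.symm.toAlgHom.comp (IsScalarTower.toAlgHom k R (ResidueField R)), fun a => ?_⟩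
  exact e.apply_symm_apply _

theorem mk_mem_maximalIdeal {p : Ideal R} [IsLocalRing (R ⧸ p)] {a : R}
    (ha : a ∈ maximalIdeal R) : Ideal.Quotient.mk p a ∈ maximalIdeal (R ⧸ p) :=
  (IsLocalRing.eq_maximalIdeal (Ideal.comap_isMaximal_of_surjective (Ideal.Quotient.mk p)
    Ideal.Quotient.mk_surjective (K := maximalIdeal (R ⧸ p)))).ge ha

/-- A linear form that vanishes on the limit fibre is nilpotent on the special fibre of the
closure, by the Nullstellensatz. Along a kernel vector `v` over `V(𝔭)` this says that a power of
its value is small compared with the ideal generated by the coordinates of `v`. -/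
theorem exists_pow_mem_of_forall_limitSpan [IsAlgClosed k] (π : R →ₐ[k] k)
    (hπ : ∀ a, algebraMap k (ResidueField R) (π a) = residue R a) {m n : ℕ}
    (A : Matrix (Fin m) (Fin n) R) {p : Ideal R} [p.IsPrime] [IsLocalRing (R ⧸ p)]
    {v : Fin n → R ⧸ p} (hv : (A.map (Ideal.Quotient.mk p)).mulVec v = 0) (a : Fin n → k)
    (ha : ∀ u ∈ limitSpan k A p, ∑ j, a j * u j = 0) :
    ∃ N, (∑ j, algebraMap k (R ⧸ p) (a j) * v j) ^ N ∈
      maximalIdeal (R ⧸ p) * Ideal.span (Set.range v) ^ N := by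
  set 𝔍 := PrimeSpectrum.vanishingIdeal (kernelBundle A p)
  set ρ : MvPolynomial (Fin n) R →+* MvPolynomial (Fin n) k := map (π : R →+* k)
  have hρ : Function.Surjective ρ := map_surjective _ fun c => ⟨algebraMap k R c, by simp⟩
  set ℓ : MvPolynomial (Fin n) k := ∑ j, C (a j) * X j
  -- The zeros of the reduction of `𝔍` modulo `𝔪` are the points of the limit fibre.
  have hℓ : ℓ ∈ vanishingIdeal k (zeroLocus k (𝔍.map ρ)) := by
    intro u hu
    have hmem : originPoint R u ∈ closure (kernelBundle A p) := by
      rw [← PrimeSpectrum.zeroLocus_vanishingIdeal_eq_closure, PrimeSpectrum.mem_zeroLocus]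
      intro P hP
      have h1 : eval₂Hom (residue R) (fun j => algebraMap k (ResidueField R) (u j))
          = (algebraMap k (ResidueField R)).comp ((eval u).comp ρ) := by
        refine MvPolynomial.ringHom_ext (fun b => ?_) (fun j => ?_)
        · simp [ρ, hπ]
        · simp [ρ]
      change eval₂Hom (residue R) (fun j => algebraMap k (ResidueField R) (u j)) P = 0
      have h2 := hu _ (Ideal.mem_map_of_mem ρ hP)
      rw [aeval_eq_eval] at h2
      rw [h1, RingHom.comp_apply, RingHom.comp_apply]
      exact (congrArg _ h2).trans (map_zero _)
    have := ha u (Submodule.subset_span hmem)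
    simpa [ℓ] using this
  rw [vanishingIdeal_zeroLocus_eq_radical] at hℓ
  obtain ⟨N, hN⟩ := hℓ
  obtain ⟨P, hP, hPℓ⟩ := (Ideal.mem_map_iff_of_surjective ρ hρ).mp hN
  refine ⟨N, ?_⟩
  have hPv : lineHom v P = 0 :=
    (PrimeSpectrum.mem_vanishingIdeal _ _).mp hP _ (linePoint_mem_kernelBundle A hv)
  set L : MvPolynomial (Fin n) R := map (algebraMap k R) ℓ
  have hLhom : (L ^ N).IsHomogeneous N := by
    have : ℓ.IsHomogeneous 1 := IsHomogeneous.sum _ _ _ fun j _ => isHomogeneous_C_mul_X _ _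
    simpa using (this.map (algebraMap k R)).pow N
  have hcoef : ∀ α, (P - L ^ N).coeff α ∈ maximalIdeal R := fun α => by
    rw [← algHom_apply_eq_zero_iff π]
    have : ρ (P - L ^ N) = 0 := by
      have hL : ρ L = ℓ := by
        simp only [ρ, L, map_map]
        rw [show (π : R →+* k).comp (algebraMap k R) = RingHom.id k from
          RingHom.ext fun c => by simp, map_id]
      rw [map_sub, map_pow, hL, hPℓ, sub_self]
    have h2 := congrArg (coeff α) this
    rwa [coeff_map, coeff_zero] at h2
  have hLv : eval v (map (Ideal.Quotient.mk p) (L ^ N))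
      = (∑ j, algebraMap k (R ⧸ p) (a j) * v j) ^ N := by
    rw [map_pow, map_pow]
    congr 1
    simp only [L, ℓ, map_sum, map_mul, map_C, map_X, eval_C, eval_X]
    rfl
  -- The degree `N` component of `P` vanishes at `v`, so only the part with coefficients in `𝔪`
  -- balances the power of the linear form.
  have hzero : eval v (map (Ideal.Quotient.mk p) (homogeneousComponent N (P - L ^ N)))
      = -(∑ j, algebraMap k (R ⧸ p) (a j) * v j) ^ N := by
    have h1 := coeff_lineHom v P N
    rw [hPv, Polynomial.coeff_zero] at h1
    rw [map_sub, map_sub, map_sub, ← h1, homogeneousComponent_eq_self hLhom, hLv, zero_sub]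
  rw [← Ideal.neg_mem_iff, ← hzero]
  refine eval_mem_mul_pow (I := Ideal.span (Set.range v)) (fun j => Ideal.subset_span ⟨j, rfl⟩)
    ((homogeneousComponent_isHomogeneous _ _).map _) fun α => ?_
  rw [coeff_map, coeff_homogeneousComponent]
  refine mk_mem_maximalIdeal ?_
  split_ifs
  · exact hcoef α
  · exact Ideal.zero_mem _

end Limits

/-! ### Complete decomposability -/

section Decomposability

theorem det_mem_pow_of_forall_mem {R : Type*} [CommRing R] {m : ℕ} {I : Ideal R}
    {A : Matrix (Fin m) (Fin m) R} (hA : ∀ i j, A i j ∈ I) : A.det ∈ I ^ m := by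
  rw [Matrix.det_apply]
  refine Ideal.sum_mem _ fun σ _ => ?_
  rw [Units.smul_def, zsmul_eq_mul]
  refine Ideal.mul_mem_left _ _ ?_
  have := Ideal.prod_mem_prod (s := Finset.univ) (I := fun _ : Fin m => I)
    (x := fun i => A (σ i) i) fun i _ => hA (σ i) i
  simpa using this

/-- Independent nonzero subspaces, as many as the dimension, are lines. -/
theorem le_span_singleton_of_iSupIndep {k : Type*} [Field k] {m : ℕ}
    {V : Fin m → Submodule k (Fin m → k)}
    (hV : iSupIndep V) {u : Fin m → Fin m → k} (hu : ∀ i, u i ∈ V i)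
    (hli : LinearIndependent k u) (i : Fin m) : V i ≤ Submodule.span k {u i} := by
  classical
  intro z hz
  have hspan := hli.span_eq_top_of_card_eq_finrank' (by simp)
  obtain ⟨a, ha⟩ := (Submodule.mem_span_range_iff_exists_fun k).mp
    (hspan ▸ Submodule.mem_top : z ∈ Submodule.span k (Set.range u))
  have h1 : z - a i • u i = ∑ j ∈ Finset.univ.erase i, a j • u j := by
    rw [← ha, ← Finset.add_sum_erase _ _ (Finset.mem_univ i), add_sub_cancel_left]
  have h2 : z - a i • u i ∈ ⨆ (j) (_ : j ≠ i), V j := by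
    rw [h1]
    exact Submodule.sum_mem _ fun j hj => Submodule.mem_iSup_of_mem j
      (Submodule.mem_iSup_of_mem (Finset.ne_of_mem_erase hj) (Submodule.smul_mem _ _ (hu j)))
  have h3 := (Submodule.disjoint_def.mp (hV i)) _
    (Submodule.sub_mem _ hz (Submodule.smul_mem _ _ (hu i))) h2
  exact Submodule.mem_span_singleton.mpr ⟨a i, (sub_eq_zero.mp h3).symm⟩

theorem isUnit_det_of_forall_offDiag_mem {R : Type*} [CommRing R] [IsLocalRing R] {m : ℕ}
    {C : Matrix (Fin m) (Fin m) R}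
    (h1 : ∀ i, C i i = 1) (h : ∀ i j, i ≠ j → C i j ∈ maximalIdeal R) : IsUnit C.det := by
  have : C.map (residue R) = 1 := by
    ext i j
    rw [Matrix.map_apply]
    by_cases hij : i = j
    · rw [hij, h1, map_one, Matrix.one_apply_eq]
    · rw [Matrix.one_apply_ne hij, residue_eq_zero_iff]
      exact h i j hij
  refine (isUnit_map_iff (residue R) _).mp ?_
  rw [RingHom.map_det, RingHom.mapMatrix_apply, this, Matrix.det_one]
  exact isUnit_one

theorem isCompletelyDecomposable_of_mul_eq {R : Type*} [CommRing R] {m : ℕ}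
    {A N W : Matrix (Fin m) (Fin m) R}
    {f : Fin m → R} (hN : IsUnit N) (hW : IsUnit W) (h : A * W = N * Matrix.diagonal f) :
    IsCompletelyDecomposable A f := by
  refine ⟨fun _ => 1, fun i => Matrix.of fun _ _ => f i, Equiv.sigmaUnique _ _,
    fun i => by simp, hN.unit⁻¹, hW.unit, ?_⟩
  rw [IsUnit.unit_spec, mul_assoc, h, ← mul_assoc]
  have : ((hN.unit⁻¹ : GL (Fin m) R) : Matrix (Fin m) (Fin m) R) * N = 1 := hN.val_inv_mul
  rw [this, one_mul]
  ext i j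
  rw [Matrix.reindex_apply, Matrix.submatrix_apply, Matrix.blockDiagonal'_apply]
  by_cases hij : i = j
  · subst hij
    simp
  · rw [Matrix.diagonal_apply_ne _ hij, dif_neg]
    simpa using hij

variable {k R : Type*} [Field k] [IsAlgClosed k] [CommRing R] [IsLocalRing R]
  [IsNoetherianRing R] [Algebra k R]

/-- If the limit fibre over the smooth hypersurface `{f = 0}` lies in the line spanned by a column
`i₀` of an invertible constant matrix `B`, then it is that line, and `B *ᵥ c`, with `c` congruent
modulo `𝔪` to the basis vector of index `i₀`, is a kernel vector of `A` over `{f = 0}`. -/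
theorem exists_kernel_vector_of_limitSpan_le (π : R →ₐ[k] k)
    (hπ : ∀ a, algebraMap k (ResidueField R) (π a) = residue R a) {d : ℕ} {x : Fin d → R}
    (hx : IsRegularSystem x) {f : R} (hf : f ∈ maximalIdeal R) (hf2 : f ∉ maximalIdeal R ^ 2)
    {m : ℕ} (A : Matrix (Fin m) (Fin m) R) (hA : f ∣ A.det)
    {B : Matrix (Fin m) (Fin m) k} (hB : IsUnit B) (i₀ : Fin m)
    (hV : limitSpan k A (Ideal.span {f}) ≤ Submodule.span k {B.col i₀}) :
    limitSpan k A (Ideal.span {f}) ≠ ⊥ ∧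
      ∃ c : Fin m → R, c i₀ = 1 ∧ (∀ j, j ≠ i₀ → c j ∈ maximalIdeal R) ∧
        ∀ i, f ∣ A.mulVec ((B.map (algebraMap k R)).mulVec c) i := by
  classical
  set p := Ideal.span {f}
  have hpm : p ≤ maximalIdeal R := (Ideal.span_singleton_le_iff_mem _).mpr hf
  have hptop : p ≠ ⊤ := fun h => Ideal.IsPrime.ne_top' (top_le_iff.mp (h ▸ hpm))
  have : Nontrivial (R ⧸ p) := Ideal.Quotient.nontrivial_iff.mpr hptop
  have : IsLocalRing (R ⧸ p) := IsLocalRing.of_surjective' _ Ideal.Quotient.mk_surjective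
  obtain ⟨e, y, hy⟩ := hx.quotient hf hf2
  let πp : R ⧸ p →ₐ[k] k := Ideal.Quotient.liftₐ p π fun a ha =>
    (algHom_apply_eq_zero_iff π).mpr (hpm ha)
  have : Infinite k := IsAlgClosed.instInfinite
  have : IsDomain (R ⧸ p) := hy.isDomain πp
  have : p.IsPrime := (Ideal.Quotient.isDomain_iff_prime p).mp this
  have hdet : (A.map (Ideal.Quotient.mk p)).det = 0 := by
    rw [← RingHom.mapMatrix_apply, ← RingHom.map_det]
    exact Ideal.Quotient.eq_zero_iff_mem.mpr (Ideal.mem_span_singleton.mpr hA)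
  obtain ⟨v, hv0, hv⟩ := Matrix.exists_mulVec_eq_zero_iff.mpr hdet
  have hBdet := (Matrix.isUnit_iff_isUnit_det B).mp hB
  -- The kernel vector in the coordinates given by the columns of `B`.
  set w : Fin m → R ⧸ p := (B⁻¹.map (algebraMap k (R ⧸ p))).mulVec v
  have hBw : (B.map (algebraMap k (R ⧸ p))).mulVec w = v := by
    rw [Matrix.mulVec_mulVec, ← Matrix.map_mul, Matrix.mul_nonsing_inv _ hBdet,
      Matrix.map_one _ (map_zero _) (map_one _), Matrix.one_mulVec]
  have hw0 : w ≠ 0 := by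
    rintro h0
    rw [h0, Matrix.mulVec_zero] at hBw
    exact hv0 hBw.symm
  have hspan : Ideal.span (Set.range v) ≤ Ideal.span (Set.range w) := by
    rw [Ideal.span_le]
    rintro _ ⟨j, rfl⟩
    rw [← hBw]
    simp only [SetLike.mem_coe, Matrix.mulVec, dotProduct]
    exact (Ideal.span (Set.range w)).sum_mem fun l _ =>
      Ideal.mul_mem_left _ _ (Ideal.subset_span (Set.mem_range_self l))
  have hpow : ∀ j, (∀ u ∈ limitSpan k A p, ∑ l, B⁻¹ j l * u l = 0) →
      ∃ N, w j ^ N ∈ maximalIdeal (R ⧸ p) * Ideal.span (Set.range w) ^ N := fun j hj => by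
    obtain ⟨N, hN⟩ := exists_pow_mem_of_forall_limitSpan π hπ A hv (B⁻¹ j) hj
    exact ⟨N, Ideal.mul_mono_right (Ideal.pow_right_mono hspan N) hN⟩
  obtain ⟨hi0, hc⟩ := exists_eq_mul_of_pow_mem
    (fun a b c hb hc h => hy.dvd_of_forall_pow_dvd πp hb hc h) hw0 i₀ (by
        intro j hj
        refine hpow j fun u hu => ?_
        obtain ⟨t, rfl⟩ := Submodule.mem_span_singleton.mp (hV hu)
        have h1 := congrFun (congrFun (Matrix.nonsing_inv_mul B hBdet) j) i₀
        rw [Matrix.one_apply_ne hj, Matrix.mul_apply] at h1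
        have h2 : ∀ l, B⁻¹ j l * (t • B.col i₀) l = t * (B⁻¹ j l * B l i₀) := fun l => by
          simp only [Pi.smul_apply, smul_eq_mul, Matrix.col_apply]
          ring
        rw [Finset.sum_congr rfl fun l _ => h2 l, ← Finset.mul_sum, h1, mul_zero])
  refine ⟨fun hbot => ?_, ?_⟩
  -- If the limit fibre were zero, the generator `w i₀` of the ideal would be nilpotent in the fibre
  -- ring as well.
  · obtain ⟨N, hN⟩ := hpow i₀ fun u hu => by
      rw [hbot, Submodule.mem_bot] at hu
      simp [hu]
    have hle : Ideal.span (Set.range w) ≤ Ideal.span {w i₀} := by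
      rw [Ideal.span_le]
      rintro _ ⟨j, rfl⟩
      obtain ⟨c, hc, -⟩ := hc j
      exact Ideal.mem_span_singleton'.mpr ⟨c, hc.symm⟩
    replace hN := Ideal.mul_mono_right (Ideal.pow_right_mono hle N) hN
    rw [Ideal.span_singleton_pow, Ideal.mem_mul_span_singleton] at hN
    obtain ⟨z, hz, hz'⟩ := hN
    rw [mul_left_eq_self₀, or_iff_left (pow_ne_zero N hi0)] at hz'
    exact Ideal.IsPrime.ne_top' ((Ideal.eq_top_iff_one _).mpr (hz' ▸ hz))
  · choose c hcw hcm using hc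
    choose b hb using fun j => Ideal.Quotient.mk_surjective (I := p) (c j)
    refine ⟨Function.update b i₀ 1, Function.update_self _ _ _, fun j hj => ?_, fun i => ?_⟩
    · rw [Function.update_of_ne hj]
      intro hu
      exact (hb j ▸ hcm j hj) (hu.map (Ideal.Quotient.mk p))
    · rw [← Ideal.mem_span_singleton, ← Ideal.Quotient.eq_zero_iff_mem]
      have hcw' : w = w i₀ • (Ideal.Quotient.mk p ∘ Function.update b i₀ 1) := by
        funext j
        by_cases hj : j = i₀
        · rw [hj, Pi.smul_apply, Function.comp_apply, Function.update_self, map_one, smul_eq_mul,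
            mul_one]
        · rw [Pi.smul_apply, Function.comp_apply, Function.update_of_ne hj, hb, smul_eq_mul,
            mul_comm]
          exact hcw j
      have h1 := congrFun hv i
      rw [← hBw, hcw', Matrix.mulVec_smul, Matrix.mulVec_smul, Pi.smul_apply, Pi.zero_apply,
        smul_eq_mul, mul_eq_zero, or_iff_right hi0] at h1
      rw [← h1]
      have h2 : ∀ (M : Matrix (Fin m) (Fin m) R) (u : Fin m → R),
          (M.map (Ideal.Quotient.mk p)).mulVec (Ideal.Quotient.mk p ∘ u)
            = Ideal.Quotient.mk p ∘ M.mulVec u := fun M u => by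
        funext l
        exact (RingHom.map_mulVec _ _ _ _).symm
      rw [show B.map (algebraMap k (R ⧸ p)) = (B.map (algebraMap k R)).map (Ideal.Quotient.mk p) from
        rfl, h2, h2]
      rfl

/-- The number of hypersurfaces is the size of the matrix, so independence forces each limit fibre
to be a line; the kernel vectors over the hypersurfaces then form an invertible matrix that
diagonalizes `A`. -/
theorem isCompletelyDecomposable_of_iSupIndep (π : R →ₐ[k] k)
    (hπ : ∀ a, algebraMap k (ResidueField R) (π a) = residue R a) {d : ℕ} {x : Fin d → R}
    (hx : IsRegularSystem x) {m r : ℕ} (A : Matrix (Fin m) (Fin m) R) {f : Fin r → R}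
    (hm : 0 < m) (hA : ∀ i j, A i j ∈ maximalIdeal R)
    (hf : ∀ i, f i ∈ maximalIdeal R ∧ f i ∉ maximalIdeal R ^ 2)
    (hdet : Ideal.span {A.det} = ⨅ i, Ideal.span {f i})
    (hind : iSupIndep fun i => limitSpan k A (Ideal.span {f i})) :
    IsCompletelyDecomposable A f := by
  classical
  have : Infinite k := IsAlgClosed.instInfinite
  have : IsDomain R := hx.isDomain π
  have hfdvd : ∀ i, f i ∣ A.det := fun i => by
    rw [← Ideal.span_singleton_le_span_singleton, hdet]
    exact iInf_le _ i
  obtain ⟨c₀, hc₀⟩ : A.det ∣ ∏ i, f i := by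
    rw [← Ideal.mem_span_singleton, hdet, Ideal.mem_iInf]
    exact fun i => Ideal.mem_span_singleton.mpr (Finset.dvd_prod_of_mem f (Finset.mem_univ i))
  have hf0 : ∀ i, f i ≠ 0 := fun i h0 => (hf i).2 (h0 ▸ Ideal.zero_mem _)
  have hprod0 : ∏ i, f i ≠ 0 := Finset.prod_ne_zero_iff.mpr fun i _ => hf0 i
  have hdet0 : A.det ≠ 0 := fun h0 => hprod0 (by rw [hc₀, h0, zero_mul])
  have hmr : m ≤ r := by
    by_contra! hlt
    have h1 := hx.prod_notMem_pow π hf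
    rw [Fintype.card_fin] at h1
    refine h1 (Ideal.pow_le_pow_right hlt ?_)
    rw [hc₀]
    exact Ideal.mul_mem_right _ _ (det_mem_pow_of_forall_mem hA)
  -- The zero space lies in every line, so the identity matrix and any column serve here.
  have hne : ∀ i, limitSpan k A (Ideal.span {f i}) ≠ ⊥ := fun i hbot =>
    (exists_kernel_vector_of_limitSpan_le π hπ hx (hf i).1 (hf i).2 A (hfdvd i)
      (B := 1) isUnit_one ⟨0, hm⟩ (hbot ▸ bot_le)).1 hbot
  choose u hu hu0 using fun i => Submodule.exists_mem_ne_zero_of_ne_bot (hne i)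
  have hli : LinearIndependent k u := hind.linearIndependent _ hu hu0
  obtain rfl : r = m := by
    have := hli.fintype_card_le_finrank
    rw [Fintype.card_fin, Module.finrank_fin_fun] at this
    exact le_antisymm this hmr
  set B : Matrix (Fin r) (Fin r) k := Matrix.of fun l i => u i l
  have hB : IsUnit B := Matrix.linearIndependent_cols_iff_isUnit.mp hli
  choose c hc1 hcm hcdvd using fun i => (exists_kernel_vector_of_limitSpan_le π hπ hx (hf i).1
    (hf i).2 A (hfdvd i) hB i (le_span_singleton_of_iSupIndep hind hu hli i)).2
  set C : Matrix (Fin r) (Fin r) R := Matrix.of fun j i => c i j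
  have hC : IsUnit C.det := isUnit_det_of_forall_offDiag_mem hc1 fun i j hij => hcm j i hij
  set W := B.map (algebraMap k R) * C
  have hW : IsUnit W.det := by
    rw [Matrix.det_mul]
    refine IsUnit.mul ?_ hC
    rw [← RingHom.mapMatrix_apply, ← RingHom.map_det]
    exact ((Matrix.isUnit_iff_isUnit_det B).mp hB).map (algebraMap k R)
  choose N hN using hcdvd
  have hAW : A * W = (Matrix.of fun i j => N j i) * Matrix.diagonal f := by
    ext i j
    rw [Matrix.mul_diagonal, Matrix.of_apply, mul_comm, ← hN j i, ← Matrix.mul_assoc,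
      Matrix.mulVec_mulVec]
    rfl
  have hNdet : IsUnit (Matrix.of fun i j => N j i).det := by
    have h1 := congrArg Matrix.det hAW
    rw [Matrix.det_mul A W, Matrix.det_mul _ (Matrix.diagonal f), Matrix.det_diagonal, hc₀, mul_left_comm,
      mul_right_inj' hdet0] at h1
    exact isUnit_of_mul_isUnit_left (h1 ▸ hW)
  exact isCompletelyDecomposable_of_mul_eq ((Matrix.isUnit_iff_isUnit_det _).mpr hNdet)
    ((Matrix.isUnit_iff_isUnit_det _).mpr hW) hAW

end Decomposability

/-! ### Minors and kernel vectors -/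

section Minors

variable {R : Type*} [CommRing R] {m n : ℕ}

/-- The kernel vector of Cramer's rule: `t + 1` columns of `A` are combined with the `t`-minors of
`t` rows as coefficients. -/
theorem exists_mulVec_eq_det {t : ℕ} (A : Matrix (Fin m) (Fin n) R) (r : Fin t → Fin m)
    {c : Fin t → Fin n} (hc : Function.Injective c) {j : Fin n} (hj : j ∉ Set.range c) :
    ∃ y : Fin n → R,
      (∀ i, A.mulVec y i = (A.submatrix (Fin.cons i r) (Fin.cons j c : Fin (t + 1) → Fin n)).det) ∧
        y j = (A.submatrix r c).det := by
  classical
  set c' : Fin (t + 1) → Fin n := Fin.cons j c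
  have hc' : Function.Injective c' := Fin.cons_injective_iff.mpr ⟨hj, hc⟩
  set b : Fin (t + 1) → R := fun l => (-1) ^ (l : ℕ) * (A.submatrix r (c' ∘ l.succAbove)).det
  refine ⟨∑ l, b l • Pi.single (c' l) 1, fun i => ?_, ?_⟩
  · rw [Matrix.det_succ_row_zero, Matrix.mulVec_sum, Finset.sum_apply]
    refine Finset.sum_congr rfl fun l _ => ?_
    rw [Matrix.mulVec_smul, Matrix.mulVec_single_one, Pi.smul_apply, smul_eq_mul, Matrix.col_apply]
    simp only [b, Matrix.submatrix_apply, Matrix.submatrix_submatrix, Fin.cons_zero]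
    rw [show (Fin.cons i r : Fin (t + 1) → Fin m) ∘ Fin.succ = r from
      funext fun a => Fin.cons_succ _ _ _]
    ring
  · rw [Finset.sum_apply, Finset.sum_eq_single 0]
    · have h0 : c' 0 = j := rfl
      have hs : c' ∘ Fin.succ = c := rfl
      simp [b, h0, hs]
    · intro l _ hl
      have : j ≠ c' l := fun h => hl (hc' (h.symm.trans rfl))
      rw [Pi.smul_apply, Pi.single_eq_of_ne this, smul_zero]
    · simp

theorem det_submatrix_eq_zero_of_not_injective {t : ℕ} (A : Matrix (Fin m) (Fin n) R)
    (r : Fin t → Fin m) {c : Fin t → Fin n} (hc : ¬ Function.Injective c) :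
    (A.submatrix r c).det = 0 := by
  obtain ⟨i, j, hij, hne⟩ := Function.not_injective_iff.mp hc
  exact Matrix.det_zero_of_column_eq hne fun a => by simp [hij]

theorem exists_notMem_range {t : ℕ} (h : t < n) (c : Fin t → Fin n) : ∃ j, j ∉ Set.range c := by
  by_contra! hall
  have := Fintype.card_le_of_surjective c hall
  simp only [Fintype.card_fin] at this
  omega

theorem minorsIdeal_le_of_lt (A : Matrix (Fin m) (Fin n) R) (hmn : m < n) {I : Ideal R}
    (h : ∀ w : Fin n → R, A.mulVec w = 0 → ∀ j, w j ∈ I) : minorsIdeal m A ≤ I := by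
  rw [minorsIdeal, Ideal.span_le]
  rintro _ ⟨r, c, rfl⟩
  by_cases hc : Function.Injective c
  · obtain ⟨j, hj⟩ := exists_notMem_range hmn c
    obtain ⟨y, hy, hyj⟩ := exists_mulVec_eq_det A r hc hj
    rw [← hyj]
    refine h y (funext fun i => ?_) j
    have hnot : ¬ Function.Injective (Fin.cons i r : Fin (m + 1) → Fin m) := fun hinj => by
      have := Fintype.card_le_of_injective _ hinj
      simp at this
    obtain ⟨a, b, hab, hne⟩ := Function.not_injective_iff.mp hnot
    rw [hy, Pi.zero_apply]
    exact Matrix.det_zero_of_row_eq hne (funext fun l => by simp [hab])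
  · rw [det_submatrix_eq_zero_of_not_injective A r hc]
    exact I.zero_mem

/-- McCoy's theorem: a nonzero scalar cannot annihilate all `t`-minors of an injective matrix with
at least `t` columns. -/
theorem eq_zero_of_mul_minors_eq_zero (A : Matrix (Fin m) (Fin n) R)
    (h : ∀ w : Fin n → R, A.mulVec w = 0 → w = 0) {a : R} (t : ℕ) (ht : t ≤ n)
    (ha : ∀ (r : Fin t → Fin m) (c : Fin t → Fin n), a * (A.submatrix r c).det = 0) : a = 0 := by
  induction t with
  | zero => simpa using ha Fin.elim0 Fin.elim0
  | succ t ih =>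
    refine ih (by omega) fun r c => ?_
    by_cases hc : Function.Injective c
    · obtain ⟨j, hj⟩ := exists_notMem_range (Nat.lt_of_succ_le ht) c
      obtain ⟨y, hy, hyj⟩ := exists_mulVec_eq_det A r hc hj
      have h0 : a • y = 0 := h _ (funext fun i => by
        rw [Matrix.mulVec_smul, Pi.smul_apply, hy, smul_eq_mul, ha, Pi.zero_apply])
      rw [← hyj]
      exact congrFun h0 j
    · rw [det_submatrix_eq_zero_of_not_injective A r hc, mul_zero]

theorem minorsIdeal_fg (t : ℕ) (A : Matrix (Fin m) (Fin n) R) : (minorsIdeal t A).FG := by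
  refine Submodule.fg_span ?_
  refine (Set.finite_range fun rc : (Fin t → Fin m) × (Fin t → Fin n) =>
    (A.submatrix rc.1 rc.2).det).subset ?_
  rintro _ ⟨r, c, rfl⟩
  exact ⟨(r, c), rfl⟩

theorem det_dvd_det_submatrix (A : Matrix (Fin m) (Fin m) R) (r c : Fin m → Fin m) :
    A.det ∣ (A.submatrix r c).det := by
  by_cases hr : Function.Injective r
  · by_cases hc : Function.Injective c
    · let er := Equiv.ofBijective r (Finite.injective_iff_bijective.mp hr)
      let ec := Equiv.ofBijective c (Finite.injective_iff_bijective.mp hc)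
      have h1 : A.submatrix r c = (A.submatrix er id).submatrix id ec := rfl
      rw [h1, Matrix.det_permute', Matrix.det_permute]
      exact Dvd.dvd.mul_left (Dvd.dvd.mul_left dvd_rfl _) _
    · rw [det_submatrix_eq_zero_of_not_injective A r hc]
      exact dvd_zero _
  · rw [← Matrix.det_transpose (A.submatrix r c), Matrix.transpose_submatrix,
      det_submatrix_eq_zero_of_not_injective _ c hr]
    exact dvd_zero _

theorem minorsIdeal_self (A : Matrix (Fin m) (Fin m) R) : minorsIdeal m A = Ideal.span {A.det} := by
  refine le_antisymm (Ideal.span_le.mpr ?_) ((Ideal.span_singleton_le_iff_mem _).mpr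
    (Ideal.subset_span ⟨id, id, by rw [Matrix.submatrix_id_id]⟩))
  rintro _ ⟨r, c, rfl⟩
  exact Ideal.mem_span_singleton.mpr (det_dvd_det_submatrix A r c)

end Minors

/-! ### Kernel fibres of a block diagonal matrix -/

section Blocks

theorem rank_fromBlocks_zero {K l m n o : Type*} [Field K] [Fintype l] [Fintype m] [Fintype n]
    [Fintype o] (A : Matrix l n K) (D : Matrix m o K) :
    (Matrix.fromBlocks A 0 0 D).rank = A.rank + D.rank := by
  let φ := LinearEquiv.sumArrowLequivProdArrow n o K K
  let ψ := LinearEquiv.sumArrowLequivProdArrow l m K K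
  have h : (Matrix.fromBlocks A 0 0 D).mulVecLin
      = ψ.symm.toLinearMap ∘ₗ (A.mulVecLin.prodMap D.mulVecLin) ∘ₗ φ.toLinearMap := by
    ext w i
    simp only [LinearMap.comp_apply, Matrix.mulVecLin_apply, Matrix.fromBlocks_mulVec,
      Matrix.zero_mulVec, add_zero, zero_add]
    rcases i with i | i <;> rfl
  rw [Matrix.rank, h, LinearMap.range_comp, LinearMap.range_comp_of_range_eq_top _ φ.range]
  rw [LinearEquiv.finrank_map_eq ψ.symm, LinearMap.range_prodMap]
  have hinj : Function.Injective ((LinearMap.range A.mulVecLin).subtype.prodMap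
      (LinearMap.range D.mulVecLin).subtype) :=
    Function.Injective.prodMap (Submodule.injective_subtype _) (Submodule.injective_subtype _)
  have := LinearMap.finrank_range_of_inj hinj
  rwa [LinearMap.range_prodMap, Submodule.range_subtype, Submodule.range_subtype,
    Module.finrank_prod] at this

variable {R : Type*} [CommRing R] {m n m₁ m₂ : ℕ}

theorem rankAt_eq_add {A : Matrix (Fin m) (Fin n) R} {U : GL (Fin m) R} {V : GL (Fin n) R}
    {n₁ n₂ : ℕ} {e : Fin m₁ ⊕ Fin m₂ ≃ Fin m} {e' : Fin n₁ ⊕ Fin n₂ ≃ Fin n}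
    {A₁ : Matrix (Fin m₁) (Fin n₁) R} {A₂ : Matrix (Fin m₂) (Fin n₂) R}
    (h : (U : Matrix (Fin m) (Fin m) R) * A * (V : Matrix (Fin n) (Fin n) R)
      = Matrix.reindex e e' (Matrix.fromBlocks A₁ 0 0 A₂)) (x : PrimeSpectrum R) :
    rankAt A x = rankAt A₁ x + rankAt A₂ x := by
  set g := algebraMap R x.asIdeal.ResidueField
  have hunit : ∀ {t : ℕ} (M : GL (Fin t) R), IsUnit ((M : Matrix (Fin t) (Fin t) R).map g).det :=
    fun M => by
      rw [← RingHom.mapMatrix_apply, ← RingHom.map_det]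
      exact ((Matrix.isUnit_iff_isUnit_det _).mp M.isUnit).map g
  have h1 := congrArg (fun M : Matrix (Fin m) (Fin n) R => (M.map g).rank) h
  simp only [Matrix.map_mul, Matrix.reindex_apply, ← Matrix.submatrix_map] at h1
  rw [Matrix.rank_mul_eq_left_of_isUnit_det _ _ (hunit V),
    Matrix.rank_mul_eq_right_of_isUnit_det _ _ (hunit U), Matrix.rank_submatrix,
    Matrix.fromBlocks_map, Matrix.map_zero _ (map_zero g), Matrix.map_zero _ (map_zero g),
    rank_fromBlocks_zero] at h1
  exact h1

theorem rankAt_eq_of_det_notMem {t : ℕ} {B : Matrix (Fin t) (Fin t) R} {x : PrimeSpectrum R}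
    (h : B.det ∉ x.asIdeal) : rankAt B x = t :=
  le_antisymm (Matrix.rank_le_width _)
    (le_rankAt (r := id) (c := id) (by rwa [Matrix.submatrix_id_id]))

theorem det_notMem_of_rankAt_eq {t : ℕ} {B : Matrix (Fin t) (Fin t) R} {x : PrimeSpectrum R}
    (h : rankAt B x = t) : B.det ∉ x.asIdeal := by
  obtain ⟨r, c, hrc⟩ := exists_minor_notMem B x
  generalize rankAt B x = s at h r c
  subst h
  exact fun hd => hrc (Ideal.mem_of_dvd _ (det_dvd_det_submatrix B r c) hd)

/-- If `det A₂` is a non-zero-divisor modulo `det A₁`, it does not vanish at any point of the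
bundle locus over `{det A₁ = 0}`: such a point specializes from one where `det A₂` does not
vanish, and there the rank would be larger. -/
theorem det_notMem_of_mem_bundleLocus {A : Matrix (Fin m) (Fin n) R} {U : GL (Fin m) R}
    {V : GL (Fin n) R} {e : Fin m₁ ⊕ Fin m₂ ≃ Fin m} {e' : Fin m₁ ⊕ Fin m₂ ≃ Fin n}
    {A₁ : Matrix (Fin m₁) (Fin m₁) R} {A₂ : Matrix (Fin m₂) (Fin m₂) R}
    (h : (U : Matrix (Fin m) (Fin m) R) * A * (V : Matrix (Fin n) (Fin n) R)
      = Matrix.reindex e e' (Matrix.fromBlocks A₁ 0 0 A₂))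
    (hreg : ∀ a, A₂.det * a ∈ Ideal.span {A₁.det} → a ∈ Ideal.span {A₁.det})
    {y : PrimeSpectrum R} (hy : y ∈ bundleLocus A (Ideal.span {A₁.det})) :
    A₂.det ∉ y.asIdeal := by
  obtain ⟨hyJ, W, hWo, hyW, hW⟩ := hy
  have hregpow : ∀ (N : ℕ) (a : R), A₂.det ^ N * a ∈ Ideal.span {A₁.det} →
      a ∈ Ideal.span {A₁.det} := fun N => by
    induction N with
    | zero => simp
    | succ N ih =>
      intro a ha
      rw [pow_succ', mul_assoc] at ha
      exact ih a (hreg _ ha)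
  -- A prime below `y` that contains `det A₁` but not `det A₂`.
  have hdisj : Disjoint (Ideal.span {A₁.det} : Set R)
      ((y.asIdeal.primeCompl ⊔ Submonoid.powers A₂.det : Submonoid R) : Set R) := by
    refine Set.disjoint_left.mpr fun z hz hz' => ?_
    obtain ⟨s, hs, _, ⟨N, rfl⟩, rfl⟩ := Submonoid.mem_sup.mp hz'
    exact hs (hyJ (hregpow N s (by rwa [mul_comm])))
  obtain ⟨p, hp, hJp, hpd⟩ := Ideal.exists_le_prime_disjoint _ _ hdisj
  have hd₂ : A₂.det ∉ p := fun hmem => Set.disjoint_left.mp hpd hmem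
    ((le_sup_right : Submonoid.powers A₂.det ≤ _) (Submonoid.mem_powers _))
  have hpy : p ≤ y.asIdeal := fun a ha => by
    by_contra hay
    exact Set.disjoint_left.mp hpd ha ((le_sup_left : y.asIdeal.primeCompl ≤ _) hay)
  let x : PrimeSpectrum R := ⟨p, hp⟩
  have hxy : x ⤳ y := (PrimeSpectrum.le_iff_specializes x y).mp hpy
  have hrank := hW x ⟨hxy.mem_open hWo hyW, hJp⟩
  rw [rankAt_eq_add h, rankAt_eq_add h, rankAt_eq_of_det_notMem (x := x) hd₂] at hrank
  have h1 := rankAt_mono A₁ (x := x) (y := y) hpy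
  have h2 : rankAt A₂ y ≤ m₂ := Matrix.rank_le_width _
  exact det_notMem_of_rankAt_eq (by omega)

open MvPolynomial in
/-- Over the bundle locus of `{det A₁ = 0}` the second block is invertible, so the kernels, hence
also their limits, have vanishing coordinates in the second block. -/
theorem mulVec_residue_eq_zero_of_mem_limitSpan {k R : Type*} [Field k] [CommRing R]
    [IsLocalRing R] [Algebra k R] {m n m₁ m₂ : ℕ} {A : Matrix (Fin m) (Fin n) R} {U : GL (Fin m) R}
    {V : GL (Fin n) R} {e : Fin m₁ ⊕ Fin m₂ ≃ Fin m} {e' : Fin m₁ ⊕ Fin m₂ ≃ Fin n}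
    {A₁ : Matrix (Fin m₁) (Fin m₁) R} {A₂ : Matrix (Fin m₂) (Fin m₂) R}
    (h : (U : Matrix (Fin m) (Fin m) R) * A * (V : Matrix (Fin n) (Fin n) R)
      = Matrix.reindex e e' (Matrix.fromBlocks A₁ 0 0 A₂))
    (hreg : ∀ a, A₂.det * a ∈ Ideal.span {A₁.det} → a ∈ Ideal.span {A₁.det})
    {u : Fin n → k} (hu : u ∈ limitSpan k A (Ideal.span {A₁.det})) (j : Fin m₂) :
    ((((V⁻¹ : GL (Fin n) R) : Matrix (Fin n) (Fin n) R).map (residue R)).mulVec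
      (algebraMap k (ResidueField R) ∘ u)) (e' (Sum.inr j)) = 0 := by
  set V' : Matrix (Fin n) (Fin n) R := ((V⁻¹ : GL (Fin n) R) : Matrix (Fin n) (Fin n) R)
  set z : Fin n → MvPolynomial (Fin n) R := (V'.map C).mulVec X
  have hker : ∀ q ∈ kernelBundle A (Ideal.span {A₁.det}), z (e' (Sum.inr j)) ∈ q.asIdeal := by
    rintro q ⟨⟨-, hq⟩, hqY⟩
    have hd : A₂.det ∉ (PrimeSpectrum.comap C q).asIdeal := det_notMem_of_mem_bundleLocus h hreg hqY
    set ψ := Ideal.Quotient.mk q.asIdeal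
    set g := ψ.comp (C : R →+* MvPolynomial (Fin n) R)
    have hAX : (A.map g).mulVec (ψ ∘ X) = 0 := funext fun i => by
      have := Ideal.Quotient.eq_zero_iff_mem.mpr (hq i)
      rw [map_sum] at this
      simpa [Matrix.mulVec, dotProduct, g] using this
    have hzV : ψ ∘ z = (V'.map g).mulVec (ψ ∘ X) := funext fun i => by
      rw [Function.comp_apply, RingHom.map_mulVec]
      rfl
    have hVV : (V : Matrix (Fin n) (Fin n) R) * V' = 1 := V.mul_inv
    have hBz : ((Matrix.reindex e e' (Matrix.fromBlocks A₁ 0 0 A₂)).map g).mulVec (ψ ∘ z) = 0 := by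
      rw [hzV, ← h, Matrix.mulVec_mulVec, ← Matrix.map_mul, Matrix.mul_assoc, hVV, Matrix.mul_one,
        Matrix.map_mul, ← Matrix.mulVec_mulVec, hAX, Matrix.mulVec_zero]
    have hA₂ : (A₂.map g).mulVec (ψ ∘ z ∘ e' ∘ Sum.inr) = 0 := funext fun i => by
      have h1 := congrFun hBz (e (Sum.inr i))
      rw [Matrix.reindex_apply, ← Matrix.submatrix_map, Matrix.submatrix_mulVec_equiv,
        Function.comp_apply, Equiv.symm_apply_apply, Matrix.fromBlocks_map,
        Matrix.fromBlocks_mulVec, Sum.elim_inr, Matrix.map_zero _ (map_zero g),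
        Matrix.zero_mulVec, zero_add] at h1
      exact h1
    have hdet : (A₂.map g).det ≠ 0 := by
      rw [← RingHom.mapMatrix_apply, ← RingHom.map_det]
      exact fun h0 => hd ((Ideal.Quotient.eq_zero_iff_mem (I := q.asIdeal)).mp h0)
    exact Ideal.Quotient.eq_zero_iff_mem.mp
      (congrFun (Matrix.eq_zero_of_mulVec_eq_zero hdet hA₂) j)
  have hclosure : closure (kernelBundle A (Ideal.span {A₁.det}))
      ⊆ PrimeSpectrum.zeroLocus {z (e' (Sum.inr j))} :=
    closure_minimal (fun q hq => by simpa using hker q hq) (PrimeSpectrum.isClosed_zeroLocus _)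
  have heq : ∀ (u : Fin n → k) i, eval₂Hom (residue R) (fun l => algebraMap k (ResidueField R) (u l)) (z i)
      = (V'.map (residue R)).mulVec (algebraMap k (ResidueField R) ∘ u) i := fun u i => by
    simp [z, Matrix.mulVec, dotProduct]
  refine Submodule.span_induction (p := fun u _ => ((V'.map (residue R)).mulVec
    (algebraMap k (ResidueField R) ∘ u)) (e' (Sum.inr j)) = 0) ?_ ?_ ?_ ?_ hu
  · intro u hu
    rw [← heq]
    exact hclosure hu (Set.mem_singleton _)
  · rw [show algebraMap k (ResidueField R) ∘ (0 : Fin n → k) = 0 from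
      funext fun _ => map_zero _, Matrix.mulVec_zero, Pi.zero_apply]
  · intro u v _ _ hu hv
    rw [show algebraMap k (ResidueField R) ∘ (u + v) = algebraMap k (ResidueField R) ∘ u
      + algebraMap k (ResidueField R) ∘ v from funext fun _ => map_add _ _ _,
      Matrix.mulVec_add, Pi.add_apply, hu, hv, add_zero]
  · intro c u _ hu
    rw [show algebraMap k (ResidueField R) ∘ (c • u) = algebraMap k (ResidueField R) c •
      (algebraMap k (ResidueField R) ∘ u) from funext fun _ => map_mul _ _ _,
      Matrix.mulVec_smul, Pi.smul_apply, hu, smul_zero]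

/-- The condition on `ker A` forces both blocks of a decomposition to be square. Their determinants
are then regular modulo each other, so after the change of coordinates that brings `A` to block
form the two limit spaces lie in complementary coordinate subspaces. -/
theorem disjoint_limitSpan_of_isDecomposable {k R : Type*} [Field k] [CommRing R] [IsLocalRing R]
    [Algebra k R] {m n : ℕ} (A : Matrix (Fin m) (Fin n) R) {J₁ J₂ : Ideal R} (hmn : m ≤ n)
    {S : Set R} (hS : S ⊆ nonZeroDivisors R) (hAS : minorsIdeal m A = Ideal.span S)
    (hker : ∀ w : Fin n → R, A.mulVec w = 0 → ∀ j, w j ∈ minorsIdeal m A)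
    (hJ₁ : J₁ ≠ ⊤) (hJ₂ : J₂ ≠ ⊤) (hAJ : minorsIdeal m A = J₁ * J₂) (hJ : J₁ ⊓ J₂ = J₁ * J₂)
    (hdec : IsDecomposable A J₁ J₂) : Disjoint (limitSpan k A J₁) (limitSpan k A J₂) := by
  obtain ⟨m₁, m₂, n₁, n₂, e, e', A₁, A₂, hA₁, hA₂, U, V, h⟩ := hdec
  -- The empty set generates `⊥` by non-zero-divisors, so this needs the condition on `ker A`.
  have hI0 : minorsIdeal m A ≠ ⊥ := fun h0 => one_ne_zero
    (eq_zero_of_mul_minors_eq_zero A (a := 1)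
      (fun w hw => funext fun j => (Ideal.mem_bot.mp (h0 ▸ hker w hw j))) m hmn fun r c => by
        rw [one_mul, ← Ideal.mem_bot, ← h0]
        exact Ideal.subset_span ⟨r, c, rfl⟩)
  have hVV : ((V⁻¹ : GL (Fin n) R) : Matrix (Fin n) (Fin n) R) * V = 1 := V.inv_mul
  have hUU : ((U⁻¹ : GL (Fin m) R) : Matrix (Fin m) (Fin m) R) * U = 1 := U.inv_mul
  have hblock : ∀ w : Fin n₁ ⊕ Fin n₂ → R, (Matrix.fromBlocks A₁ 0 0 A₂).mulVec w = 0 →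
      ∀ j, w j ∈ minorsIdeal m A := fun w hw j => by
    have h1 : A.mulVec ((V : Matrix (Fin n) (Fin n) R).mulVec (w ∘ e'.symm)) = 0 := by
      have h2 : (Matrix.reindex e e' (Matrix.fromBlocks A₁ 0 0 A₂)).mulVec (w ∘ e'.symm) = 0 := by
        rw [Matrix.reindex_apply, Matrix.submatrix_mulVec_equiv, Function.comp_assoc,
          Equiv.symm_symm, Equiv.symm_comp_self, Function.comp_id, hw]
        rfl
      rw [← h, Matrix.mul_assoc, ← Matrix.mulVec_mulVec, ← Matrix.mulVec_mulVec] at h2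
      have h3 := congrArg ((U⁻¹ : GL (Fin m) R) : Matrix (Fin m) (Fin m) R).mulVec h2
      rwa [Matrix.mulVec_mulVec, hUU, Matrix.one_mulVec, Matrix.mulVec_zero] at h3
    have h4 : w ∘ e'.symm = ((V⁻¹ : GL (Fin n) R) : Matrix (Fin n) (Fin n) R).mulVec
        ((V : Matrix (Fin n) (Fin n) R).mulVec (w ∘ e'.symm)) := by
      rw [Matrix.mulVec_mulVec, hVV, Matrix.one_mulVec]
    have h5 := congrFun h4 (e' j)
    rw [Function.comp_apply, Equiv.symm_apply_apply] at h5
    rw [h5]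
    simp only [Matrix.mulVec, dotProduct]
    exact Ideal.sum_mem _ fun l _ => Ideal.mul_mem_left _ _ (hker _ h1 l)
  have hker₁ : ∀ w : Fin n₁ → R, A₁.mulVec w = 0 → ∀ j, w j ∈ minorsIdeal m A := fun w hw j => by
    refine hblock (Sum.elim w 0) ?_ (Sum.inl j)
    rw [Matrix.fromBlocks_mulVec]
    simp [hw]
  have hker₂ : ∀ w : Fin n₂ → R, A₂.mulVec w = 0 → ∀ j, w j ∈ minorsIdeal m A := fun w hw j => by
    refine hblock (Sum.elim 0 w) ?_ (Sum.inr j)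
    rw [Matrix.fromBlocks_mulVec]
    simp [hw]
  -- By Nakayama's lemma, a block with more columns than rows would make its minors vanish.
  have hn₁ : n₁ ≤ m₁ := by
    by_contra! hlt
    have h1 := minorsIdeal_le_of_lt A₁ hlt hker₁
    rw [hAJ, hA₁, mul_comm] at h1
    have h2 := Submodule.eq_bot_of_le_smul_of_le_jacobson_bot J₂ J₁ (hA₁ ▸ minorsIdeal_fg m₁ A₁) h1
      ((le_maximalIdeal hJ₂).trans (maximalIdeal_le_jacobson _))
    exact hI0 (by rw [hAJ, h2, Ideal.bot_mul])
  have hn₂ : n₂ ≤ m₂ := by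
    by_contra! hlt
    have h1 := minorsIdeal_le_of_lt A₂ hlt hker₂
    rw [hAJ, hA₂] at h1
    have h2 := Submodule.eq_bot_of_le_smul_of_le_jacobson_bot J₁ J₂ (hA₂ ▸ minorsIdeal_fg m₂ A₂) h1
      ((le_maximalIdeal hJ₁).trans (maximalIdeal_le_jacobson _))
    exact hI0 (by rw [hAJ, h2, Ideal.mul_bot])
  have hcm := Fintype.card_congr e
  have hcn := Fintype.card_congr e'
  simp only [Fintype.card_sum, Fintype.card_fin] at hcm hcn
  obtain rfl : n₁ = m₁ := by omega
  obtain rfl : n₂ = m₂ := by omega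
  rw [minorsIdeal_self] at hA₁ hA₂
  subst hA₁ hA₂
  rw [Ideal.span_singleton_mul_span_singleton] at hAJ hJ
  obtain ⟨s, hs⟩ : S.Nonempty := by
    by_contra hempty
    rw [Set.not_nonempty_iff_eq_empty.mp hempty, Ideal.span_empty] at hAS
    exact hI0 hAS
  have hd : A₁.det * A₂.det ∈ nonZeroDivisors R := by
    obtain ⟨a, ha⟩ := Ideal.mem_span_singleton'.mp
      (hAJ ▸ hAS ▸ Ideal.subset_span hs : s ∈ Ideal.span {A₁.det * A₂.det})
    exact (mul_mem_nonZeroDivisors.mp (ha ▸ hS hs)).2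
  obtain ⟨hd₁, hd₂⟩ := mul_mem_nonZeroDivisors.mp hd
  have hreg₁ : ∀ a, A₂.det * a ∈ Ideal.span {A₁.det} → a ∈ Ideal.span {A₁.det} := fun a ha => by
    have h1 : A₂.det * a ∈ Ideal.span {A₁.det * A₂.det} := hJ ▸
      ⟨ha, Ideal.mul_mem_right _ _ (Ideal.mem_span_singleton_self _)⟩
    obtain ⟨b, hb⟩ := Ideal.mem_span_singleton'.mp h1
    refine Ideal.mem_span_singleton'.mpr ⟨b, ?_⟩
    rw [← mul_cancel_left_mem_nonZeroDivisors hd₂, ← hb]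
    ring
  have hreg₂ : ∀ a, A₁.det * a ∈ Ideal.span {A₂.det} → a ∈ Ideal.span {A₂.det} := fun a ha => by
    have h1 : A₁.det * a ∈ Ideal.span {A₁.det * A₂.det} := hJ ▸
      ⟨Ideal.mul_mem_right _ _ (Ideal.mem_span_singleton_self _), ha⟩
    obtain ⟨b, hb⟩ := Ideal.mem_span_singleton'.mp h1
    refine Ideal.mem_span_singleton'.mpr ⟨b, ?_⟩
    rw [← mul_cancel_left_mem_nonZeroDivisors hd₁, ← hb]
    ring
  have h' : (U : Matrix (Fin m) (Fin m) R) * A * (V : Matrix (Fin n) (Fin n) R)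
      = Matrix.reindex ((Equiv.sumComm _ _).trans e) ((Equiv.sumComm _ _).trans e')
        (Matrix.fromBlocks A₂ 0 0 A₁) := by
    rw [h, ← Matrix.fromBlocks_submatrix_sum_swap_sum_swap]
    rfl
  refine Submodule.disjoint_def.mpr fun u hu₁ hu₂ => ?_
  have hzero : (((V⁻¹ : GL (Fin n) R) : Matrix (Fin n) (Fin n) R).map (residue R)).mulVec
      (algebraMap k (ResidueField R) ∘ u) = 0 := funext fun i => by
    obtain ⟨j | j, rfl⟩ := e'.surjective i
    · exact mulVec_residue_eq_zero_of_mem_limitSpan h' hreg₂ hu₂ j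
    · exact mulVec_residue_eq_zero_of_mem_limitSpan h hreg₁ hu₁ j
  have hVV' : (V : Matrix (Fin n) (Fin n) R) * ((V⁻¹ : GL (Fin n) R) : Matrix (Fin n) (Fin n) R)
      = 1 := V.mul_inv
  have h1 := congrArg ((V : Matrix (Fin n) (Fin n) R).map (residue R)).mulVec hzero
  rw [Matrix.mulVec_mulVec, ← Matrix.map_mul, hVV', Matrix.map_one _ (map_zero _) (map_one _),
    Matrix.one_mulVec, Matrix.mulVec_zero] at h1
  exact funext fun j => (map_eq_zero (algebraMap k (ResidueField R))).mp (congrFun h1 j)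

end Blocks

end KernelFibres

open KernelFibres IsLocalRing in
theorem mainTheorem6 {k R : Type*} [Field k] [IsAlgClosed k] [CharZero k]
    [CommRing R] [IsLocalRing R] [Algebra k R]
    (hk : Function.Bijective (algebraMap k (ResidueField R))) :
    (∀ (m n : ℕ) (A : Matrix (Fin m) (Fin n) R) (J₁ J₂ : Ideal R),
      1 < m → m ≤ n →
      (∀ i j, A i j ∈ maximalIdeal R) →
      (∃ S : Set R, S ⊆ nonZeroDivisors R ∧ minorsIdeal m A = Ideal.span S) →
      (∀ w : Fin n → R, A.mulVec w = 0 → ∀ j, w j ∈ minorsIdeal m A) →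
      J₁ ≠ ⊤ → J₂ ≠ ⊤ →
      minorsIdeal m A = J₁ * J₂ → J₁ ⊓ J₂ = J₁ * J₂ →
      IsDecomposable A J₁ J₂ →
      Disjoint (limitSpan k A J₁) (limitSpan k A J₂)) ∧
    (IsRegularLocalRing R →
      ∀ (m r : ℕ) (A : Matrix (Fin m) (Fin m) R) (f : Fin r → R),
      1 < m →
      (∀ i j, A i j ∈ maximalIdeal R) →
      (∀ i, f i ∈ maximalIdeal R ∧ f i ∉ maximalIdeal R ^ 2) →
      Ideal.span {A.det} = ⨅ i, Ideal.span {f i} →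
      iSupIndep (fun i => limitSpan k A (Ideal.span {f i})) →
      IsCompletelyDecomposable A f) := by
  obtain ⟨π, hπ⟩ := exists_residue_algHom hk
  refine ⟨?_, ?_⟩
  · rintro m n A J₁ J₂ - hmn - ⟨S, hS, hAS⟩ hker hJ₁ hJ₂ hAJ hJ hdec
    exact disjoint_limitSpan_of_isDecomposable A hmn hS hAS hker hJ₁ hJ₂ hAJ hJ hdec
  · intro hreg m r A f hm hA hf hdet hind
    obtain ⟨d, x, hx⟩ := exists_isRegularSystem R
    exact isCompletelyDecomposable_of_iSupIndep π hπ hx A (by omega) hA hf hdet hind
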